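/- Consider two underactuated surface vessels $i=1,2$. Vessel $i$ has symmetric positive definite rigid-body and added mass matrices of the form $M_x=\begin{bmatrix} m_{11}^x&0&0\\0&m_{22}^x&m_{23}^x\\0&m_{23}^x&m_{33}^x\end{bmatrix}$, $x\in\{RB,A\}$, with $m_{jk}=m_{jk}^{RB}+m_{jk}^{A}$ and $\Gamma=m_{22}m_{33}-m_{23}^2$, real damping coefficients $d_{11},d_{11}^q,d_{22},d_{23},d_{32},d_{33}$, and positive constant autopilot gains $k_u,k_e,k_\psi,k_r,k_d,\lambda,\gamma_u,\gamma_r$ (all of these may differ between the vessels; vessel indices are omitted below where no confusion arises). Put $$X(u,u_c)=\tfrac1\Gamma\big(m_{33}(-d_{23}-m_{11}(u-u_c)-m_{11}^{RB}u_c)+m_{23}d_{33}+m_{23}(m_{23}(u-u_c)+m_{23}^{RB}u_c+m_{22}^Au_c)\big),$$ $$Y(u,u_c)=\tfrac1\Gamma\big(-m_{33}d_{22}+m_{23}d_{32}+m_{23}(m_{22}^A-m_{11}^A)(u-u_c)\big),$$ and let the regressors be $$\phi_u(u,r,\psi)=\begin{bmatrix}-\frac{d_{11}+2d_{11}^qu}{m_{11}}\cos\psi-\frac{m_{11}^A-m_{22}^A}{m_{11}}r\sin\psi\\-\frac{d_{11}+2d_{11}^qu}{m_{11}}\sin\psi+\frac{m_{11}^A-m_{22}^A}{m_{11}}r\cos\psi\\-d_{11}^q\cos^2\psi\\-d_{11}^q\sin^2\psi\\-2d_{11}^q\cos\psi\sin\psi\end{bmatrix},\qquad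 \phi_r(u,v,r,\psi)=\begin{bmatrix}a_1\cos\psi-a_2\sin\psi\\a_1\sin\psi+a_2\cos\psi\\-\frac{m_{22}}\Gamma(m_{11}^A-m_{22}^A)\cos\psi\sin\psi\\\frac{m_{22}}\Gamma(m_{11}^A-m_{22}^A)\cos\psi\sin\psi\\\frac{m_{22}}\Gamma(m_{11}^A-m_{22}^A)(1-2\sin^2\psi)\end{bmatrix},$$ $a_1=\frac{m_{22}}\Gamma\big((m_{11}^A-m_{22}^A)v+(m_{23}^A-m_{22}^A)r\big)-\frac{m_{23}}\Gamma m_{11}^Ar$, $a_2=\frac{m_{22}}\Gamma\big(d_{32}-(m_{11}^A-m_{22}^A)u\big)-\frac{m_{23}}\Gamma d_{22}$. Let a smooth planar path be parametrized by arc length $\theta\in\mathbb R$, with tangent angle $\gamma_p(\theta)$ and bounded curvature $\kappa=\gamma_p'$; let $(V_x,V_y)$ be a constant ocean current, let $k_\theta,\mu>0$, and let the desired surge speeds $u_{d,i}:\mathbb R\to(0,\infty)$ be continuously differentiable signals. The state consists of the path-following errors $x,y$, the path variable $\theta$ and, for each vessel, $\tilde u_i,\tilde\psi_i,s_i,v_i\in\mathbb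 R$ and $\tilde\theta_{r,i},\tilde\theta_{u,i}\in\mathbb R^5$. Put $\Delta=\sqrt{\mu+x^2+y^2}$, $u_i=u_{d,i}+\tilde u_i$, $\psi_{d,i}=\gamma_p(\theta)-\arctan(y/\Delta)-\arctan(v_i/u_{d,i})$, $\psi_i=\psi_{d,i}+\tilde\psi_i$, $u_{c,i}=V_x\cos\psi_i+V_y\sin\psi_i$, $v_{c,i}=-V_x\sin\psi_i+V_y\cos\psi_i$, $U_i=\sqrt{u_i^2+v_i^2}$, $U_{d,i}=\sqrt{u_{d,i}^2+v_i^2}$, and let the course $\chi_i$ be $\psi_i$ plus the polar angle of the vector $(u_i,v_i)$. The closed-loop system is $$\dot\theta=\tfrac12U_1\cos(\chi_1-\gamma_p)+\tfrac12U_2\cos(\chi_2-\gamma_p)+k_\theta\frac{x}{\sqrt{1+x^2}},$$ $$\dot x=-k_\theta\frac{x}{\sqrt{1+x^2}}+\dot\theta\kappa(\theta)y,\qquad \dot y=-\frac{\frac12(U_{d,1}+U_{d,2})y}{\sqrt{\Delta^2+y^2}}-\kappa(\theta)\dot\theta x+G_1,$$ $$G_1=\tfrac12\sum_{i=1}^2\Big[\tilde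 u_i\sin(\psi_i-\gamma_p)+U_{d,i}(1-\cos\tilde\psi_i)\sin\arctan\tfrac y\Delta+U_{d,i}\cos\arctan\tfrac y\Delta\,\sin\tilde\psi_i\Big],$$ $$\dot{\tilde u}_i=-\big(\tfrac{d_{11}}{m_{11}}+k_u\big)\tilde u_i-\phi_u^T\tilde\theta_{u,i}-k_e\,\mathrm{sign}(\tilde u_i),\qquad \dot{\tilde\psi}_i=-\lambda\tilde\psi_i+s_i,$$ $$\dot s_i=-k_\psi\tilde\psi_i-k_rs_i-\phi_r^T\tilde\theta_{r,i}-k_d\,\mathrm{sign}(s_i),\qquad \dot{\tilde\theta}_{r,i}=\gamma_r\phi_rs_i,\qquad \dot{\tilde\theta}_{u,i}=\gamma_u\phi_u\tilde u_i,$$ $$\dot v_i=X(u_i,u_{c,i})r_i+Y(u_i,u_{c,i})(v_i-v_{c,i}),$$ with the regressors evaluated at $(u_i,r_i,\psi_i)$ and $(u_i,v_i,r_i,\psi_i)$. The yaw rate is $r_i=r_{d,i}+\tilde r_i$, where $\tilde r_i=\dot{\tilde\psi}_i$ and $$r_{d,i}=\dot\psi_{d,i}=\kappa(\theta)\dot\theta-\frac{\dot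 v_iu_{d,i}-\dot u_{d,i}v_i}{u_{d,i}^2+v_i^2}-\frac{1}{\Delta^2+y^2}\Big[\Delta\dot y-y\Big(\frac{\partial\Delta}{\partial x}\dot x+\frac{\partial\Delta}{\partial y}\dot y\Big)\Big].$$ Since $\dot v_i$ contains $r_i$, this is a linear equation for $r_i$, whose coefficient is $C_i=1+\dfrac{u_{d,i}X(u_i,u_{c,i})}{u_{d,i}^2+v_i^2}$; the system is considered on the set where $C_1\neq0$ and $C_2\ne0$. Solutions are understood in the sense of Filippov. Then from every initial time $t_0$ and every initial state with $C_1,C_2\neq 0$ there starts a maximal (non-continuable) trajectory, and the trajectories are forward complete: every maximal trajectory on $[t_0,T)$, $t_0<T\le\infty$, along which the desired yaw rates remain well defined (that is, $|C_1|$ and $|C_2|$ are bounded away from $0$ on $[t_0,T)\cap[t_0,b]$ for every $b\in\mathbb R$), has $T=\infty$. -/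

import Mathlib

open MeasureTheory
open scoped ContDiff

noncomputable section

namespace BarycenterPathFollowing

/-- Independent entries of a mass matrix of a port-starboard symmetric vessel. -/
structure MassCoeffs where
  m11 : ℝ
  m22 : ℝ
  m23 : ℝ
  m33 : ℝ

/-- The mass matrix with the given entries. -/
def MassCoeffs.toMatrix (m : MassCoeffs) : Matrix (Fin 3) (Fin 3) ℝ :=
  !![m.m11, 0, 0; 0, m.m22, m.m23; 0, m.m23, m.m33]

/-- A surface vessel: rigid-body mass, hydrodynamic added mass (both symmetric positive definite)
and damping coefficients. -/
structure Vessel where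
  rb : MassCoeffs
  added : MassCoeffs
  rb_posDef : rb.toMatrix.PosDef
  added_posDef : added.toMatrix.PosDef
  d11 : ℝ
  d11q : ℝ
  d22 : ℝ
  d23 : ℝ
  d32 : ℝ
  d33 : ℝ

namespace Vessel

variable (P : Vessel)

/-- `m₁₁ = m₁₁^RB + m₁₁^A`, and similarly for the other entries. -/
def m11 : ℝ := P.rb.m11 + P.added.m11
def m22 : ℝ := P.rb.m22 + P.added.m22
def m23 : ℝ := P.rb.m23 + P.added.m23
def m33 : ℝ := P.rb.m33 + P.added.m33

/-- `Γ = m₂₂ m₃₃ - m₂₃²`. -/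
def Γ : ℝ := P.m22 * P.m33 - P.m23 ^ 2

/-- The coefficient `X(u, u_c)` of the yaw rate in the sway dynamics. -/
def X (u uc : ℝ) : ℝ :=
  1 / P.Γ * (P.m33 * (-P.d23 - P.m11 * (u - uc) - P.rb.m11 * uc) + P.m23 * P.d33
    + P.m23 * (P.m23 * (u - uc) + P.rb.m23 * uc + P.added.m22 * uc))

/-- The coefficient `Y(u, u_c)` of the relative sway velocity in the sway dynamics. -/
def Y (u uc : ℝ) : ℝ :=
  1 / P.Γ * (-P.m33 * P.d22 + P.m23 * P.d32 + P.m23 * (P.added.m22 - P.added.m11) * (u - uc))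

/-- The surge regressor `φ_u`. -/
def φu (u r ψ : ℝ) : Fin 5 → ℝ :=
  ![-(P.d11 + 2 * P.d11q * u) / P.m11 * Real.cos ψ
      - (P.added.m11 - P.added.m22) / P.m11 * r * Real.sin ψ,
    -(P.d11 + 2 * P.d11q * u) / P.m11 * Real.sin ψ
      + (P.added.m11 - P.added.m22) / P.m11 * r * Real.cos ψ,
    -P.d11q * Real.cos ψ ^ 2,
    -P.d11q * Real.sin ψ ^ 2,
    -2 * P.d11q * Real.cos ψ * Real.sin ψ]

/-- Auxiliary quantities in the yaw regressor. -/
def a1 (v r : ℝ) : ℝ :=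
  P.m22 / P.Γ * ((P.added.m11 - P.added.m22) * v + (P.added.m23 - P.added.m22) * r)
    - P.m23 / P.Γ * P.added.m11 * r
def a2 (u : ℝ) : ℝ :=
  P.m22 / P.Γ * (P.d32 - (P.added.m11 - P.added.m22) * u) - P.m23 / P.Γ * P.d22

/-- The yaw regressor `φ_r`. -/
def φr (u v r ψ : ℝ) : Fin 5 → ℝ :=
  ![Real.cos ψ * P.a1 v r - Real.sin ψ * P.a2 u,
    Real.sin ψ * P.a1 v r + Real.cos ψ * P.a2 u,
    -(P.m22 / P.Γ) * (P.added.m11 - P.added.m22) * Real.cos ψ * Real.sin ψ,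
    P.m22 / P.Γ * (P.added.m11 - P.added.m22) * Real.cos ψ * Real.sin ψ,
    P.m22 / P.Γ * (P.added.m11 - P.added.m22) * (1 - 2 * Real.sin ψ ^ 2)]

end Vessel

/-- The (positive, constant) gains of the surge and yaw autopilots of one vessel. -/
structure Gains where
  ku : ℝ
  ke : ℝ
  kψ : ℝ
  kr : ℝ
  kd : ℝ
  lam : ℝ
  γu : ℝ
  γr : ℝ
  ku_pos : 0 < ku
  ke_pos : 0 < ke
  kψ_pos : 0 < kψ
  kr_pos : 0 < kr
  kd_pos : 0 < kd
  lam_pos : 0 < lam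
  γu_pos : 0 < γu
  γr_pos : 0 < γr

/-- A smooth planar path parametrized by arc length, with tangent angle `γ`. -/
structure SmoothPath where
  xp : ℝ → ℝ
  yp : ℝ → ℝ
  γ : ℝ → ℝ
  γ_smooth : ContDiff ℝ ∞ γ
  hasDerivAt_xp : ∀ θ, HasDerivAt xp (Real.cos (γ θ)) θ
  hasDerivAt_yp : ∀ θ, HasDerivAt yp (Real.sin (γ θ)) θ

/-- The signed curvature of the path. -/
def SmoothPath.κ (p : SmoothPath) (θ : ℝ) : ℝ := deriv p.γ θ

/-- All data of the closed loop: two vessels with their autopilot gains, the path, the constant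
ocean current `(Vx, Vy)` in the inertial frame, the gain `kθ` of the path variable update law, the
constant `μ` in the lookahead distance, and the desired surge speed signals `ud i`. -/
structure Setup where
  vessel : Fin 2 → Vessel
  gains : Fin 2 → Gains
  path : SmoothPath
  Vx : ℝ
  Vy : ℝ
  kθ : ℝ
  kθ_pos : 0 < kθ
  μ : ℝ
  μ_pos : 0 < μ
  ud : Fin 2 → ℝ → ℝ
  ud_contDiff : ∀ i, ContDiff ℝ 1 (ud i)
  ud_pos : ∀ i t, 0 < ud i t

/-- The closed-loop state: path-following errors `x, y`, path variable `θ` and, for each vessel,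
the surge error `ut`, the heading error `ψt`, the sliding variable `s = ψt' + lam ψt`, the
estimation errors `θr, θu` of the yaw and surge adaptation laws, and the sway velocity `v`. -/
structure State where
  x : ℝ
  y : ℝ
  θ : ℝ
  ut : Fin 2 → ℝ
  ψt : Fin 2 → ℝ
  s : Fin 2 → ℝ
  θr : Fin 2 → Fin 5 → ℝ
  θu : Fin 2 → Fin 5 → ℝ
  v : Fin 2 → ℝ

namespace Setup

variable (S : Setup) (t : ℝ) (z : State) (i : Fin 2)

/-- The path tangential angle at the current path variable. -/
def γp : ℝ := S.path.γ z.θ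

/-- The curvature of the path at the current path variable. -/
def κp : ℝ := S.path.κ z.θ

/-- The lookahead distance `Δ`. -/
def Δ : ℝ := √(S.μ + z.x ^ 2 + z.y ^ 2)

/-- The surge velocity `u = u_d + ut`. -/
def u : ℝ := S.ud i t + z.ut i

/-- The desired heading: line-of-sight guidance with sideslip compensation. -/
def ψd : ℝ :=
  S.γp z - Real.arctan (z.y / S.Δ z) - Real.arctan (z.v i / S.ud i t)

/-- The heading `ψ = ψ_d + ψt`. -/
def ψ : ℝ := S.ψd t z i + z.ψt i

/-- The ocean current in the body frame of the vessel. -/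
def uc : ℝ := Real.cos (S.ψ t z i) * S.Vx + Real.sin (S.ψ t z i) * S.Vy
def vc : ℝ := -Real.sin (S.ψ t z i) * S.Vx + Real.cos (S.ψ t z i) * S.Vy

/-- The total speed `U = √(u² + v²)`. -/
def U : ℝ := √(S.u t z i ^ 2 + z.v i ^ 2)

/-- The course `χ`: the heading plus the angle of the velocity vector `(u, v)` in the body frame. -/
def χ : ℝ := S.ψ t z i + Complex.arg ⟨S.u t z i, z.v i⟩

/-- The total desired speed `U_d = √(u_d² + v²)`. -/
def Ud : ℝ := √(S.ud i t ^ 2 + z.v i ^ 2)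

/-- The right-hand side of the update law for the path variable. -/
def θdot : ℝ :=
  1 / 2 * S.U t z 0 * Real.cos (S.χ t z 0 - S.γp z)
    + 1 / 2 * S.U t z 1 * Real.cos (S.χ t z 1 - S.γp z)
    + S.kθ * (z.x / √(1 + z.x ^ 2))

/-- The along-track velocity of a vessel in terms of its surge and sway velocities. -/
lemma U_mul_cos (a : ℝ) :
    S.U t z i * Real.cos (S.χ t z i - a)
      = S.u t z i * Real.cos (S.ψ t z i - a) - z.v i * Real.sin (S.ψ t z i - a) := by
  have h1 := Complex.norm_mul_cos_arg ⟨S.u t z i, z.v i⟩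
  have h2 := Complex.norm_mul_sin_arg ⟨S.u t z i, z.v i⟩
  have h3 : ‖(⟨S.u t z i, z.v i⟩ : ℂ)‖ = S.U t z i := by
    rw [Complex.norm_def, Complex.normSq_mk, U]
    ring_nf
  rw [h3] at h1 h2
  have h4 : S.χ t z i - a = (S.ψ t z i - a) + Complex.arg ⟨S.u t z i, z.v i⟩ := by
    rw [χ]; ring
  simp only at h1 h2
  rw [h4, Real.cos_add]
  linear_combination Real.cos (S.ψ t z i - a) * h1 - Real.sin (S.ψ t z i - a) * h2

/-- The contribution of one vessel to the perturbing term. -/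
def G2 : ℝ :=
  z.ut i * Real.sin (S.ψ t z i - S.γp z)
    + S.Ud t z i * (1 - Real.cos (z.ψt i)) * Real.sin (Real.arctan (z.y / S.Δ z))
    + S.Ud t z i * Real.cos (Real.arctan (z.y / S.Δ z)) * Real.sin (z.ψt i)

/-- The perturbing term in the cross-track error dynamics. -/
def G1 : ℝ := 1 / 2 * ∑ i, S.G2 t z i

/-- The along-track error dynamics. -/
def xdot : ℝ := -S.kθ * (z.x / √(1 + z.x ^ 2)) + S.θdot t z * S.κp z * z.y

/-- The cross-track error dynamics. -/
def ydot : ℝ :=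
  -(1 / 2) * (S.Ud t z 0 + S.Ud t z 1) * z.y / √(S.Δ z ^ 2 + z.y ^ 2)
    - S.κp z * S.θdot t z * z.x + S.G1 t z

/-- The sway acceleration of the vessel when its yaw rate is `r`. -/
def vdot (r : ℝ) : ℝ :=
  (S.vessel i).X (S.u t z i) (S.uc t z i) * r
    + (S.vessel i).Y (S.u t z i) (S.uc t z i) * (z.v i - S.vc t z i)

/-- The desired yaw rate, i.e. the time derivative of the desired heading, as a function of the
actual yaw rate `r`; the dependence on `r` is through the sway acceleration. Here
`∂Δ/∂x = x / Δ` and `∂Δ/∂y = y / Δ`. -/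
def rd (r : ℝ) : ℝ :=
  S.κp z * S.θdot t z
    - (S.vdot t z i r * S.ud i t - deriv (S.ud i) t * z.v i) / (S.ud i t ^ 2 + z.v i ^ 2)
    - 1 / (S.Δ z ^ 2 + z.y ^ 2) *
      (S.Δ z * S.ydot t z
        - z.y * (z.x / S.Δ z * S.xdot t z + z.y / S.Δ z * S.ydot t z))

/-- The coefficient `1 + u_d X(u, u_c) / (u_d² + v²)` of the yaw rate in the relation
`r - r_d(r) = rt`, where `rt = ψt' = s - lam ψt` is the yaw rate error. -/
def yawCoeff : ℝ :=
  1 + S.ud i t * (S.vessel i).X (S.u t z i) (S.uc t z i) / (S.ud i t ^ 2 + z.v i ^ 2)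

/-- The yaw rate error `rt = ψt' = s - lam ψt`. -/
def rt : ℝ := z.s i - (S.gains i).lam * z.ψt i

/-- The yaw rate of the vessel: the solution of `r = r_d(r) + rt`, see `eq_yawRate_iff`. -/
def yawRate : ℝ := (S.rd t z i 0 + S.rt z i) / S.yawCoeff t z i

/-- Where its coefficient does not vanish, the relation `r = r_d(r) + rt` determines the yaw rate. -/
lemma eq_yawRate_iff (h : S.yawCoeff t z i ≠ 0) (r : ℝ) :
    r = S.rd t z i r + S.rt z i ↔ r = S.yawRate t z i := by
  have key : S.rd t z i r = S.rd t z i 0 + r - S.yawCoeff t z i * r := by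
    unfold rd vdot yawCoeff
    ring
  rw [key, yawRate, eq_div_iff h]
  constructor <;> intro h <;> linarith

end Setup

/-- The Filippov regularization of the sign function. -/
def Sgn (a : ℝ) : Set ℝ := {σ | (0 < a → σ = 1) ∧ (a < 0 → σ = -1) ∧ |σ| ≤ 1}

/-- The set of times `t` with `t₀ ≤ t < T`, where `T` may be infinite. -/
def timeInterval (t₀ : ℝ) (T : EReal) : Set ℝ := {t | t₀ ≤ t ∧ (t : EReal) < T}

namespace Setup

variable (S : Setup)

/-- The closed-loop differential equations at time `t` along the curve `z`. The sign functions of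
the two autopilots are understood in the sense of Filippov. -/
structure ClosedLoopAt (z : ℝ → State) (t : ℝ) : Prop where
  x : HasDerivAt (fun τ => (z τ).x) (S.xdot t (z t)) t
  y : HasDerivAt (fun τ => (z τ).y) (S.ydot t (z t)) t
  θ : HasDerivAt (fun τ => (z τ).θ) (S.θdot t (z t)) t
  ut : ∀ i, ∃ σ ∈ Sgn ((z t).ut i), HasDerivAt (fun τ => (z τ).ut i)
    (-((S.vessel i).d11 / (S.vessel i).m11 + (S.gains i).ku) * (z t).ut i
      - (∑ k, (S.vessel i).φu (S.u t (z t) i) (S.yawRate t (z t) i) (S.ψ t (z t) i) k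
          * (z t).θu i k)
      - (S.gains i).ke * σ) t
  ψt : ∀ i, HasDerivAt (fun τ => (z τ).ψt i) (-(S.gains i).lam * (z t).ψt i + (z t).s i) t
  s : ∀ i, ∃ σ ∈ Sgn ((z t).s i), HasDerivAt (fun τ => (z τ).s i)
    (-(S.gains i).kψ * (z t).ψt i - (S.gains i).kr * (z t).s i
      - (∑ k, (S.vessel i).φr (S.u t (z t) i) ((z t).v i) (S.yawRate t (z t) i) (S.ψ t (z t) i) k
          * (z t).θr i k)
      - (S.gains i).kd * σ) t
  θr : ∀ i k, HasDerivAt (fun τ => (z τ).θr i k)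
    ((S.gains i).γr
      * (S.vessel i).φr (S.u t (z t) i) ((z t).v i) (S.yawRate t (z t) i) (S.ψ t (z t) i) k
      * (z t).s i) t
  θu : ∀ i k, HasDerivAt (fun τ => (z τ).θu i k)
    ((S.gains i).γu
      * (S.vessel i).φu (S.u t (z t) i) (S.yawRate t (z t) i) (S.ψ t (z t) i) k
      * (z t).ut i) t
  v : ∀ i, HasDerivAt (fun τ => (z τ).v i) (S.vdot t (z t) i (S.yawRate t (z t) i)) t

/-- Absolute continuity of all components of a curve on `[a, b]`. -/
structure ACOn (z : ℝ → State) (a b : ℝ) : Prop where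
  x : AbsolutelyContinuousOnInterval (fun τ => (z τ).x) a b
  y : AbsolutelyContinuousOnInterval (fun τ => (z τ).y) a b
  θ : AbsolutelyContinuousOnInterval (fun τ => (z τ).θ) a b
  ut : ∀ i, AbsolutelyContinuousOnInterval (fun τ => (z τ).ut i) a b
  ψt : ∀ i, AbsolutelyContinuousOnInterval (fun τ => (z τ).ψt i) a b
  s : ∀ i, AbsolutelyContinuousOnInterval (fun τ => (z τ).s i) a b
  θr : ∀ i k, AbsolutelyContinuousOnInterval (fun τ => (z τ).θr i k) a b
  θu : ∀ i k, AbsolutelyContinuousOnInterval (fun τ => (z τ).θu i k) a b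
  v : ∀ i, AbsolutelyContinuousOnInterval (fun τ => (z τ).v i) a b

/-- `z` is a trajectory (Filippov solution) of the closed-loop system on `[t₀, T)`. The right-hand
side is defined where the coefficients of the yaw rates do not vanish. -/
structure IsTrajectory (t₀ : ℝ) (T : EReal) (z : ℝ → State) : Prop where
  lt : (t₀ : EReal) < T
  ac : ∀ b ∈ timeInterval t₀ T, ACOn z t₀ b
  domain : ∀ t ∈ timeInterval t₀ T, ∀ i, S.yawCoeff t (z t) i ≠ 0
  eqn : ∀ᵐ t : ℝ, t ∈ timeInterval t₀ T → S.ClosedLoopAt z t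

/-- A trajectory that cannot be extended to a longer time interval. -/
structure IsMaximalTrajectory (t₀ : ℝ) (T : EReal) (z : ℝ → State) : Prop
    extends S.IsTrajectory t₀ T z where
  maximal : ∀ (T' : EReal) (z' : ℝ → State), S.IsTrajectory t₀ T' z' →
    Set.EqOn z' z (timeInterval t₀ T ∩ timeInterval t₀ T') → T' ≤ T

/-- The desired yaw rates stay well defined along the curve: on every bounded part of `[t₀, T)` the
coefficients of the yaw rates are bounded away from zero. -/
def YawRegular (t₀ : ℝ) (T : EReal) (z : ℝ → State) : Prop :=
  ∀ b : ℝ, ∃ c > 0, ∀ t ∈ timeInterval t₀ T, t ≤ b → ∀ i, c ≤ |S.yawCoeff t (z t) i|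

end Setup

end BarycenterPathFollowing

end

/-!
Local existence. The vector field is continuous up to multiples of `sign zᵢ`, added to the `i`-th
component only. Euler's scheme, applied to the field with the discontinuous sign function, gives
polygons that converge pointwise along an ultrafilter to a Lipschitz curve
(`exists_euler_limit`); bounds of a component of the field near a point of the curve are bounds of
the difference quotients of this component there. Where `zᵢ ≠ 0` this gives the equation, and where
`zᵢ = 0` it gives, at the points of differentiability, a multiplier of the sign term in `[-1, 1]`
(`exists_local_filippov`). Neither a Lipschitz condition nor uniqueness is used. A maximal
trajectory then exists by Zorn's lemma (`Setup.exists_isMaximalTrajectory`).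

Forward completeness. On a bounded interval `[t₀, T)` the following holds.
* The autopilot errors are bounded. In the derivatives of the Lyapunov functions
  `ũ² + |θ̃_u|² / γ_u` and `k_ψ ψ̃² + s² + |θ̃_r|² / γ_r` the adaptation laws cancel the regressors
  and the sign terms have the favourable sign (`Setup.IsTrajectory.exists_bound_surge`,
  `Setup.IsTrajectory.exists_bound_yaw`).
* Since the coefficients `Cᵢ` are bounded away from zero, the yaw rates, the sway accelerations and
  `θ̇` are `O(1 + |v₁| + |v₂|)`. The only delicate term is the derivative of the line-of-sight angle
  `arctan (y / Δ)`, in which the lookahead distance `Δ`, of at least the order of `1 + |x| + |y|`,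
  compensates the growth of `ẋ` and `ẏ` in the path-following errors
  (`Setup.Controlled.rd_zero_isBigO`).
* In `x ẋ + y ẏ` the terms with `κ θ̇` cancel. By Grönwall's inequality
  `1 + x² + y² + θ² + v₁² + v₂²` is bounded (`Setup.Controlled.exists_energy_growth`).

So the states stay in a compact part of the domain of the vector field, where the field is bounded.
The trajectory is Lipschitz and has a limit at `T`, which is in the domain, and local existence from
there extends the trajectory beyond `T` (`Setup.IsTrajectory.exists_extension`): it was not maximal.
-/

namespace BarycenterPathFollowing

open MeasureTheory Filter Topology Set

/-! ### Limits of Euler polygons of discontinuous vector fields -/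

section Euler

variable {ι : Type*}

/-- Euler's explicit scheme with step `τ` for `p' = h s p`, started at `z₀` at time `t₀`. -/
def eulerSeq (h : ℝ → (ι → ℝ) → ι → ℝ) (t₀ : ℝ) (z₀ : ι → ℝ) (τ : ℝ) : ℕ → ι → ℝ
  | 0 => z₀
  | j + 1 => fun i => eulerSeq h t₀ z₀ τ j i + τ * h (t₀ + j * τ) (eulerSeq h t₀ z₀ τ j) i

variable {h : ℝ → (ι → ℝ) → ι → ℝ} {t₀ : ℝ} {z₀ : ι → ℝ}

/-- Bounds of a component of the field at the nodes from `j` to `k - 1` bound the increment of that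
component of the polygon between the nodes `j` and `k`. -/
lemma eulerSeq_sub_mem {τ : ℝ} (hτ : 0 ≤ τ) {lo hi : ℝ} {i : ι} {j k : ℕ} (hjk : j ≤ k)
    (H : ∀ l, j ≤ l → l < k →
      h (t₀ + l * τ) (eulerSeq h t₀ z₀ τ l) i ∈ Icc lo hi) :
    eulerSeq h t₀ z₀ τ k i - eulerSeq h t₀ z₀ τ j i
      ∈ Icc (lo * (k * τ - j * τ)) (hi * (k * τ - j * τ)) := by
  induction k, hjk using Nat.le_induction with
  | base => simp
  | succ k hjk ih =>
    obtain ⟨h1, h2⟩ := ih fun l hl hl' => H l hl (hl'.trans k.lt_succ_self)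
    obtain ⟨h3, h4⟩ := H k hjk k.lt_succ_self
    have e : eulerSeq h t₀ z₀ τ (k + 1) i = eulerSeq h t₀ z₀ τ k i
        + τ * h (t₀ + k * τ) (eulerSeq h t₀ z₀ τ k) i := rfl
    have h5 := mul_le_mul_of_nonneg_left h3 hτ
    have h6 := mul_le_mul_of_nonneg_left h4 hτ
    rw [e]
    push_cast
    constructor <;> linarith

lemma dist_eulerSeq_le [Fintype ι] {M τ : ℝ} (hM : ∀ s p, ‖h s p‖ ≤ M) (hτ : 0 ≤ τ) (j k : ℕ) :
    dist (eulerSeq h t₀ z₀ τ j) (eulerSeq h t₀ z₀ τ k) ≤ M * |k * τ - j * τ| := by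
  have hM0 : 0 ≤ M := (norm_nonneg _).trans (hM 0 0)
  wlog hjk : j ≤ k generalizing j k
  · rw [dist_comm, abs_sub_comm]
    exact this k j (le_of_not_ge hjk)
  have hjk' : (j : ℝ) * τ ≤ k * τ := by gcongr
  rw [abs_of_nonneg (sub_nonneg.2 hjk')]
  refine (dist_pi_le_iff (by nlinarith)).2 fun i => ?_
  have H := eulerSeq_sub_mem (h := h) (t₀ := t₀) (z₀ := z₀) (i := i) (lo := -M) (hi := M) hτ hjk
    fun l _ _ => abs_le.1 ((norm_le_pi_norm (h _ _) i).trans (hM _ _))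
  rw [dist_comm, Real.dist_eq, abs_le]
  exact ⟨by linarith [H.1], H.2⟩

/-- The index of the last Euler node, with step `1 / (n + 1)` from `t₀`, that is not after `t`.
It is `0` for `t < t₀`. -/
noncomputable def eulerIndex (t₀ : ℝ) (n : ℕ) (t : ℝ) : ℕ := ⌊(t - t₀) * (n + 1)⌋₊

lemma eulerIndex_mono {n : ℕ} {a b : ℝ} (hab : a ≤ b) : eulerIndex t₀ n a ≤ eulerIndex t₀ n b :=
  Nat.floor_mono (by gcongr)

lemma eulerIndex_bounds {n : ℕ} {t : ℝ} (ht : t₀ ≤ t) :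
    eulerIndex t₀ n t * (1 / ((n : ℝ) + 1)) ≤ t - t₀ ∧
      t - t₀ ≤ eulerIndex t₀ n t * (1 / ((n : ℝ) + 1)) + 1 / ((n : ℝ) + 1) := by
  have hn : (0 : ℝ) < n + 1 := by positivity
  have h1 := Nat.floor_le (mul_nonneg (sub_nonneg.2 ht) hn.le)
  have h2 := (Nat.lt_floor_add_one ((t - t₀) * ((n : ℝ) + 1))).le
  rw [mul_one_div, ← add_div, div_le_iff₀ hn, le_div_iff₀ hn]
  exact ⟨h1, h2⟩

lemma tendsto_eulerIndex {t : ℝ} (ht : t₀ ≤ t) :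
    Tendsto (fun n : ℕ => eulerIndex t₀ n t * (1 / ((n : ℝ) + 1))) atTop (𝓝 (t - t₀)) := by
  have h0 : Tendsto (fun n : ℕ => (t - t₀) - 1 / ((n : ℝ) + 1)) atTop (𝓝 (t - t₀)) := by
    simpa using tendsto_const_nhds.sub (tendsto_one_div_add_atTop_nhds_zero_nat (𝕜 := ℝ))
  refine tendsto_of_tendsto_of_tendsto_of_le_of_le h0 tendsto_const_nhds (fun n => ?_) fun n => ?_
  · have := (eulerIndex_bounds (n := n) ht).2
    dsimp only
    linarith
  · exact (eulerIndex_bounds ht).1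

/-- A bounded vector field, without any continuity, has a Lipschitz curve that is a limit of its
Euler polygons. Any interval containing the values of a component of the field near a point of
the curve contains the difference quotients of that component of the curve there.
The limit is taken pointwise along an ultrafilter, which makes a compactness theorem for
functions unnecessary. -/
theorem exists_euler_limit [Fintype ι] (h : ℝ → (ι → ℝ) → ι → ℝ) {M : ℝ}
    (hM : ∀ s p, ‖h s p‖ ≤ M) (t₀ : ℝ) (z₀ : ι → ℝ) :
    ∃ z : ℝ → ι → ℝ, z t₀ = z₀ ∧
      (∀ a b, t₀ ≤ a → t₀ ≤ b → dist (z a) (z b) ≤ M * |b - a|) ∧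
      ∀ t, t₀ < t → ∀ (i : ι) (lo hi η : ℝ), 0 < η →
        (∀ s p, |s - t| < η → dist p (z t) < η → h s p i ∈ Icc lo hi) →
        ∃ δ > 0, ∀ a b, a ≤ b → |a - t| < δ → |b - t| < δ →
          z b i - z a i ∈ Icc (lo * (b - a)) (hi * (b - a)) := by
  have hM0 : 0 ≤ M := (norm_nonneg _).trans (hM 0 0)
  let τ : ℕ → ℝ := fun n => 1 / ((n : ℝ) + 1)
  have hτ : ∀ n, 0 ≤ τ n := fun n => by positivity
  let Z : ℕ → ℝ → ι → ℝ := fun n t => eulerSeq h t₀ z₀ (τ n) (eulerIndex t₀ n t)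
  have hu : (hyperfilter ℕ : Filter ℕ) ≤ atTop := by
    rw [← Nat.cofinite_eq_atTop]
    exact hyperfilter_le_cofinite
  have hlim : ∀ t, ∃ x, t₀ ≤ t → Tendsto (fun n => Z n t) (hyperfilter ℕ) (𝓝 x) := by
    intro t
    by_cases ht : t₀ ≤ t
    · have hc := (isCompact_closedBall z₀ (M * (t - t₀))).ultrafilter_le_nhds
        ((hyperfilter ℕ).map fun n => Z n t) (by
          rw [le_principal_iff, Ultrafilter.coe_map, mem_map]
          refine univ_mem' fun n => ?_
          have h1 := dist_eulerSeq_le (t₀ := t₀) (z₀ := z₀) hM (hτ n) (eulerIndex t₀ n t) 0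
          have h2 := (eulerIndex_bounds (n := n) ht).1
          have h3 : (0 : ℝ) ≤ eulerIndex t₀ n t * τ n := mul_nonneg (Nat.cast_nonneg _) (hτ n)
          simp only [Nat.cast_zero, zero_mul, zero_sub, abs_neg, abs_of_nonneg h3] at h1
          exact h1.trans (mul_le_mul_of_nonneg_left h2 hM0))
      obtain ⟨x, -, hx⟩ := hc
      exact ⟨x, fun _ => hx⟩
    · exact ⟨0, fun h => absurd h ht⟩
  choose z hz using hlim
  have hind : ∀ t, t₀ ≤ t →
      Tendsto (fun n : ℕ => eulerIndex t₀ n t * τ n) (hyperfilter ℕ) (𝓝 (t - t₀)) :=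
    fun t ht => (tendsto_eulerIndex ht).mono_left hu
  refine ⟨z, ?_, fun a b ha hb => ?_, fun t ht i lo hi η hη H => ?_⟩
  · refine tendsto_nhds_unique (hz t₀ le_rfl) ?_
    have : (fun n => Z n t₀) = fun _ => z₀ := by
      funext n
      simp [Z, eulerIndex, eulerSeq]
    rw [this]
    exact tendsto_const_nhds
  · refine le_of_tendsto_of_tendsto ((hz a ha).dist (hz b hb))
      (((hind b hb).sub (hind a ha)).abs.const_mul M |>.trans_eq ?_) ?_
    · ring_nf
    · exact Eventually.of_forall fun n => dist_eulerSeq_le hM (hτ n) _ _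
  · -- For times within `δ` of `t`, nodes of the fine polygons are within `2 δ` of `t` in time, hence
    -- within `3 δ M < η / 2` of the node used at time `t`, which is close to `z t`.
    set δ := min (η / (8 * (M + 1))) (t - t₀) with hδ
    have hδ0 : 0 < δ := lt_min (by positivity) (sub_pos.2 ht)
    have hδ1 : δ * (8 * (M + 1)) ≤ η := by
      rw [← le_div_iff₀ (by positivity)]
      exact min_le_left _ _
    have hδ2 : δ ≤ t - t₀ := min_le_right _ _
    refine ⟨δ, hδ0, fun a b hab ha hb => ?_⟩
    rw [abs_lt] at ha hb
    have ha0 : t₀ ≤ a := by linarith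
    have hb0 : t₀ ≤ b := by linarith
    have hτδ : ∀ᶠ n in (hyperfilter ℕ : Filter ℕ), τ n < δ :=
      ((tendsto_one_div_add_atTop_nhds_zero_nat (𝕜 := ℝ)).mono_left hu).eventually_lt_const hδ0
    have hnear : ∀ᶠ n in (hyperfilter ℕ : Filter ℕ), dist (Z n t) (z t) < η / 4 :=
      (hz t ht.le) (Metric.ball_mem_nhds _ (by positivity))
    have key : ∀ᶠ n in (hyperfilter ℕ : Filter ℕ), Z n b i - Z n a i ∈
        Icc (lo * (eulerIndex t₀ n b * τ n - eulerIndex t₀ n a * τ n))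
          (hi * (eulerIndex t₀ n b * τ n - eulerIndex t₀ n a * τ n)) := by
      filter_upwards [hτδ, hnear] with n h1 h2
      refine eulerSeq_sub_mem (hτ n) (eulerIndex_mono hab) fun l hl hl' => ?_
      have hla : (eulerIndex t₀ n a : ℝ) * τ n ≤ l * τ n :=
        mul_le_mul_of_nonneg_right (Nat.cast_le.2 hl) (hτ n)
      have hlb : (l : ℝ) * τ n ≤ eulerIndex t₀ n b * τ n :=
        mul_le_mul_of_nonneg_right (Nat.cast_le.2 hl'.le) (hτ n)
      have ea := (eulerIndex_bounds (n := n) ha0).2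
      have eb := (eulerIndex_bounds (n := n) hb0).1
      have et := eulerIndex_bounds (n := n) ht.le
      change eulerIndex t₀ n t * τ n ≤ _ ∧ _ ≤ _ + τ n at et
      change _ ≤ _ + τ n at ea
      change _ * τ n ≤ _ at eb
      have hδη : 8 * δ ≤ η := by nlinarith
      refine H _ _ ?_ ?_
      · rw [abs_lt]
        constructor <;> linarith
      · have h3 := dist_eulerSeq_le (t₀ := t₀) (z₀ := z₀) hM (hτ n) l (eulerIndex t₀ n t)
        have h4 : |eulerIndex t₀ n t * τ n - l * τ n| ≤ 3 * δ := by
          rw [abs_le]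
          constructor <;> linarith
        have h5 := mul_le_mul_of_nonneg_left h4 hM0
        have h6 := dist_triangle (eulerSeq h t₀ z₀ (τ n) l) (Z n t) (z t)
        change dist _ (Z n t) ≤ _ at h3
        nlinarith
    have hdiff := (hind b hb0).sub (hind a ha0)
    rw [sub_sub_sub_cancel_right] at hdiff
    have hZ := ((continuous_apply i).tendsto _ |>.comp (hz b hb0)).sub
      ((continuous_apply i).tendsto _ |>.comp (hz a ha0))
    exact ⟨le_of_tendsto_of_tendsto (hdiff.const_mul lo) hZ (key.mono fun n hn => hn.1),
      le_of_tendsto_of_tendsto hZ (hdiff.const_mul hi) (key.mono fun n hn => hn.2)⟩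

end Euler

/-! ### Local existence of Filippov solutions -/

section Filippov

lemma hasDerivAt_of_increment_mem {g : ℝ → ℝ} {d t : ℝ}
    (H : ∀ ε > 0, ∃ δ > 0, ∀ a b, a ≤ b → |a - t| < δ → |b - t| < δ →
      g b - g a ∈ Icc ((d - ε) * (b - a)) ((d + ε) * (b - a))) : HasDerivAt g d t := by
  rw [hasDerivAt_iff_isLittleO, Asymptotics.isLittleO_iff]
  intro ε hε
  obtain ⟨δ, hδ, h⟩ := H ε hε
  have hb : ∀ᶠ x in 𝓝 t, |x - t| < δ := Metric.ball_mem_nhds t hδ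
  filter_upwards [hb] with x hx
  rw [Real.norm_eq_abs, Real.norm_eq_abs, smul_eq_mul, abs_le]
  rcases le_total t x with htx | htx
  · obtain ⟨h1, h2⟩ := h t x htx (by simpa) hx
    rw [abs_of_nonneg (sub_nonneg.2 htx)]
    constructor <;> linarith
  · obtain ⟨h1, h2⟩ := h x t htx hx (by simpa)
    rw [abs_of_nonpos (sub_nonpos.2 htx)]
    constructor <;> linarith

lemma deriv_mem_of_increment_mem {g : ℝ → ℝ} {d t δ lo hi : ℝ} (hg : HasDerivAt g d t) (hδ : 0 < δ)
    (h : ∀ a b, a ≤ b → |a - t| < δ → |b - t| < δ →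
      g b - g a ∈ Icc (lo * (b - a)) (hi * (b - a))) : d ∈ Icc lo hi := by
  have h1 := (hasDerivWithinAt_iff_tendsto_slope' (s := Ioi t) (by simp)).1 hg.hasDerivWithinAt
  have hb : ∀ᶠ x in 𝓝[>] t, |x - t| < δ := nhdsWithin_le_nhds (Metric.ball_mem_nhds t hδ)
  have h2 : ∀ᶠ x in 𝓝[>] t, slope g t x ∈ Icc lo hi := by
    filter_upwards [hb, self_mem_nhdsWithin] with x hx hx'
    have hpos : 0 < x - t := sub_pos.2 hx'
    obtain ⟨h3, h4⟩ := h t x (le_of_lt hx') (by simpa) hx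
    rw [slope_def_field]
    exact ⟨(le_div_iff₀ hpos).2 h3, (div_le_iff₀ hpos).2 h4⟩
  exact isClosed_Icc.mem_of_tendsto h1 h2

lemma abs_sign_le (a : ℝ) : |Real.sign a| ≤ 1 := by
  rcases Real.sign_apply_eq a with h | h | h <;> rw [h] <;> norm_num

lemma eventually_sign_eq {a : ℝ} (ha : a ≠ 0) : ∀ᶠ b in 𝓝 a, Real.sign b = Real.sign a := by
  rcases lt_or_gt_of_ne ha with h | h
  · filter_upwards [eventually_lt_nhds h] with b hb
    rw [Real.sign_of_neg hb, Real.sign_of_neg h]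
  · filter_upwards [eventually_gt_nhds h] with b hb
    rw [Real.sign_of_pos hb, Real.sign_of_pos h]

lemma sign_mem_Sgn {a : ℝ} : Real.sign a ∈ Sgn a :=
  ⟨Real.sign_of_pos, Real.sign_of_neg, abs_sign_le a⟩

/-- Local existence of Filippov solutions of `zᵢ' = fᵢ(t, z) - kᵢ sign zᵢ` for `f` continuous.
Away from `zᵢ = 0` the field is continuous, and the derivative of a limit of Euler polygons is
the value of the field. At a point with `zᵢ = 0` where the limit is differentiable, the estimate
of the difference quotients puts `fᵢ - zᵢ'` into `[-kᵢ, kᵢ]`. -/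
theorem exists_local_filippov {ι : Type*} [Fintype ι] {f : ℝ → (ι → ℝ) → ι → ℝ}
    {k : ι → ℝ} (hk : ∀ i, 0 ≤ k i) {D : Set (ℝ × (ι → ℝ))} (hD : IsOpen D)
    (hf : ContinuousOn (fun q : ℝ × (ι → ℝ) => f q.1 q.2) D) {t₀ : ℝ} {z₀ : ι → ℝ}
    (h₀ : (t₀, z₀) ∈ D) :
    ∃ δ > 0, ∃ M : NNReal, ∃ z : ℝ → ι → ℝ, z t₀ = z₀ ∧ LipschitzOnWith M z (Ici t₀) ∧
      (∀ t ∈ Icc t₀ (t₀ + δ), (t, z t) ∈ D) ∧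
      ∀ᵐ t : ℝ, t ∈ Ioo t₀ (t₀ + δ) → ∀ i, ∃ σ ∈ Sgn (z t i),
        HasDerivAt (fun τ => z τ i) (f t (z t) i - k i * σ) t := by
  classical
  obtain ⟨r, hr, hrD⟩ := Metric.nhds_basis_closedBall.mem_iff.1 (hD.mem_nhds h₀)
  set B := Metric.closedBall (t₀, z₀) r with hB
  obtain ⟨M₀, hM₀⟩ := (isCompact_closedBall (t₀, z₀) r).exists_bound_of_continuousOn (hf.mono hrD)
  -- The field is cut off outside the ball `B`, which the curve does not leave before `t₀ + δ`.
  let h : ℝ → (ι → ℝ) → ι → ℝ := fun s p i =>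
    if (s, p) ∈ B then f s p i - k i * Real.sign (p i) else 0
  have hM₀0 : 0 ≤ M₀ := (norm_nonneg _).trans (hM₀ (t₀, z₀) (Metric.mem_closedBall_self hr.le))
  set M := M₀ + ‖k‖ with hMdef
  have hM0 : 0 ≤ M := by positivity
  have hM : ∀ s p, ‖h s p‖ ≤ M := by
    intro s p
    refine (pi_norm_le_iff_of_nonneg hM0).2 fun i => ?_
    by_cases hq : (s, p) ∈ B
    · simp only [h, if_pos hq]
      refine (norm_sub_le _ _).trans (add_le_add ((norm_le_pi_norm (f s p) i).trans (hM₀ _ hq)) ?_)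
      rw [norm_mul]
      exact (mul_le_of_le_one_right (norm_nonneg _) (abs_sign_le _)).trans (norm_le_pi_norm k i)
    · simpa only [h, if_neg hq, norm_zero] using hM0
  obtain ⟨z, hz0, hzL, hz⟩ := exists_euler_limit h hM t₀ z₀
  have hLip : LipschitzOnWith ⟨M, hM0⟩ z (Ici t₀) := LipschitzOnWith.of_dist_le_mul
    fun a ha b hb => by
      rw [dist_comm a b, Real.dist_eq]
      exact hzL a b ha hb
  set δ := r / (2 * (M + 1)) with hδ
  have hδ0 : 0 < δ := by positivity
  have hδM : δ * (M + 1) = r / 2 := by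
    rw [hδ]
    field_simp
  have hball : ∀ t ∈ Icc t₀ (t₀ + δ), (t, z t) ∈ Metric.ball (t₀, z₀) r := by
    intro t ht
    rw [Metric.mem_ball, Prod.dist_eq, max_lt_iff]
    constructor
    · rw [Real.dist_eq, abs_of_nonneg (sub_nonneg.2 ht.1)]
      nlinarith [ht.2]
    · have := hzL t t₀ ht.1 le_rfl
      rw [hz0, abs_sub_comm, abs_of_nonneg (sub_nonneg.2 ht.1)] at this
      have h2 : M * (t - t₀) ≤ M * δ := mul_le_mul_of_nonneg_left (by linarith [ht.2]) hM0
      dsimp only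
      linarith
  refine ⟨δ, hδ0, ⟨M, hM0⟩, z, hz0, hLip,
    fun t ht => hrD (Metric.ball_subset_closedBall (hball t ht)), ?_⟩
  have hdiff : ∀ᵐ t : ℝ, ∀ i, t ∈ uIcc t₀ (t₀ + δ) → DifferentiableAt ℝ (fun τ => z τ i) t := by
    refine ae_all_iff.2 fun i => AbsolutelyContinuousOnInterval.ae_differentiableAt ?_
    refine LipschitzOnWith.absolutelyContinuousOnInterval (K := ⟨M, hM0⟩) ?_
    rw [uIcc_of_le (by linarith)]
    exact LipschitzOnWith.of_dist_le_mul fun a ha b hb =>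
      (dist_le_pi_dist (z a) (z b) i).trans (hLip.dist_le_mul a ha.1 b hb.1)
  filter_upwards [hdiff] with t htd ht i
  have htI : t ∈ Icc t₀ (t₀ + δ) := Ioo_subset_Icc_self ht
  have hcont : ∀ ε > 0, ∀ᶠ q in 𝓝 (t, z t), q ∈ B ∧ |f q.1 q.2 i - f t (z t) i| < ε := by
    intro ε hε
    have hq : ∀ᶠ q in 𝓝 (t, z t), q ∈ B := mem_of_superset
      (Metric.isOpen_ball.mem_nhds (hball t htI)) Metric.ball_subset_closedBall
    refine hq.and ?_
    have hc : ContinuousAt (fun q : ℝ × (ι → ℝ) => f q.1 q.2 i) (t, z t) :=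
      (continuousAt_pi.1 (hf.continuousAt (hD.mem_nhds
        (hrD (Metric.ball_subset_closedBall (hball t htI)))))) i
    exact hc (Metric.ball_mem_nhds _ hε)
  have hloc : ∀ lo hi : ℝ, (∀ᶠ q in 𝓝 (t, z t), h q.1 q.2 i ∈ Icc lo hi) →
      ∃ δ > 0, ∀ a b, a ≤ b → |a - t| < δ → |b - t| < δ →
        z b i - z a i ∈ Icc (lo * (b - a)) (hi * (b - a)) := by
    intro lo hi hev
    obtain ⟨η, hη, hη'⟩ := Metric.eventually_nhds_iff.1 hev
    refine hz t ht.1 i lo hi η hη fun s p hs hp => hη' (y := (s, p)) ?_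
    rw [Prod.dist_eq]
    exact max_lt hs hp
  by_cases hzi : z t i = 0
  · obtain ⟨d, hd⟩ : ∃ d, HasDerivAt (fun τ => z τ i) d t :=
      ⟨_, (htd i (by rw [uIcc_of_le (by linarith)]; exact htI)).hasDerivAt⟩
    have hdk : |f t (z t) i - d| ≤ k i := by
      refine le_of_forall_pos_le_add fun ε hε => ?_
      obtain ⟨δ', hδ', H⟩ := hloc (f t (z t) i - k i - ε) (f t (z t) i + k i + ε) (by
        filter_upwards [hcont ε hε] with q hq
        simp only [h, if_pos hq.1]
        have h1 := abs_lt.1 hq.2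
        have h2 : |k i * Real.sign (q.2 i)| ≤ k i := by
          rw [abs_mul, abs_of_nonneg (hk i)]
          exact mul_le_of_le_one_right (hk i) (abs_sign_le _)
        rw [abs_le] at h2
        constructor <;> linarith)
      obtain ⟨h1, h2⟩ := deriv_mem_of_increment_mem hd hδ' H
      rw [abs_le]
      constructor <;> linarith
    -- If `k i = 0`, the multiplier is `0` by the convention on division, and `d = f t (z t) i`.
    refine ⟨(f t (z t) i - d) / k i, ⟨fun h => absurd hzi h.ne', fun h => absurd hzi h.ne, ?_⟩, ?_⟩
    · rw [abs_div, abs_of_nonneg (hk i)]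
      exact div_le_one_of_le₀ hdk (hk i)
    · rcases (hk i).eq_or_lt' with h0 | h0
      · rw [h0, abs_nonpos_iff] at hdk
        rw [h0, zero_mul, sub_zero, sub_eq_zero.1 hdk]
        exact hd
      · rw [mul_div_cancel₀ _ h0.ne', sub_sub_cancel]
        exact hd
  · refine ⟨Real.sign (z t i), sign_mem_Sgn, hasDerivAt_of_increment_mem fun ε hε => hloc _ _ ?_⟩
    have hs : ∀ᶠ q : ℝ × (ι → ℝ) in 𝓝 (t, z t), Real.sign (q.2 i) = Real.sign (z t i) :=
      (((continuous_apply i).comp continuous_snd).tendsto (t, z t)).eventually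
        (eventually_sign_eq hzi)
    filter_upwards [hcont ε hε, hs] with q hq hqs
    simp only [h, if_pos hq.1, hqs]
    have h1 := abs_lt.1 hq.2
    constructor <;> linarith

end Filippov

/-! ### Differential inequalities for absolutely continuous functions -/

section AbsolutelyContinuous

/-- **Grönwall's inequality** for an absolutely continuous function with an almost everywhere
differential inequality. -/
lemma le_mul_exp_of_absolutelyContinuous {g : ℝ → ℝ} {a b C : ℝ} (hab : a ≤ b)
    (hg : AbsolutelyContinuousOnInterval g a b)
    (h : ∀ᵐ t : ℝ, t ∈ Ioo a b → ∃ d, HasDerivAt g d t ∧ d ≤ C * g t) :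
    g b ≤ g a * Real.exp (C * (b - a)) := by
  let e : ℝ → ℝ := fun t => Real.exp (-C * t)
  have he : ∀ t, HasDerivAt e (-C * e t) t := fun t => by
    have := ((hasDerivAt_id t).const_mul (-C)).exp
    simpa [e, mul_comm] using this
  have heac : AbsolutelyContinuousOnInterval e a b := by
    refine ContDiffOn.absolutelyContinuousOnInterval (ContDiff.contDiffOn ?_)
    fun_prop
  have hint := (hg.fun_mul heac).integral_deriv_eq_sub
  have hle : ∫ t in a..b, deriv (fun t => g t * e t) t ≤ 0 := by
    have hae : ∀ᵐ t : ℝ, t ∈ Ioc a b → deriv (fun t => g t * e t) t ≤ 0 := by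
      have hb : ∀ᵐ t : ℝ, t ≠ b := by simp [ae_iff, measure_singleton]
      filter_upwards [h, hb] with t ht htb htI
      obtain ⟨d, hd, hd'⟩ := ht ⟨htI.1, lt_of_le_of_ne htI.2 htb⟩
      rw [(hd.fun_mul (he t)).deriv]
      have : 0 < e t := Real.exp_pos _
      nlinarith
    rw [intervalIntegral.integral_of_le hab]
    exact integral_nonpos_of_ae ((ae_restrict_iff' measurableSet_Ioc).2 hae)
  have h1 : g b * e b ≤ g a * e a := by linarith
  have h2 : e a = Real.exp (C * (b - a)) * e b := by
    simp only [e, ← Real.exp_add]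
    ring_nf
  rw [h2, ← mul_assoc] at h1
  exact le_of_mul_le_mul_right h1 (Real.exp_pos _)

lemma abs_sub_le_of_absolutelyContinuous {g : ℝ → ℝ} {a b M : ℝ} (hab : a ≤ b)
    (hg : AbsolutelyContinuousOnInterval g a b)
    (h : ∀ᵐ t : ℝ, t ∈ Ioo a b → ∃ d, HasDerivAt g d t ∧ |d| ≤ M) :
    |g b - g a| ≤ M * (b - a) := by
  rw [← hg.integral_deriv_eq_sub, ← abs_of_nonneg (sub_nonneg.2 hab)]
  refine intervalIntegral.norm_integral_le_of_norm_le_const_ae (f := deriv g) ?_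
  have hb : ∀ᵐ t : ℝ, t ≠ b := by simp [ae_iff, measure_singleton]
  filter_upwards [h, hb] with t ht htb htI
  rw [uIoc_of_le hab] at htI
  obtain ⟨d, hd, hd'⟩ := ht ⟨htI.1, lt_of_le_of_ne htI.2 htb⟩
  rw [hd.deriv]
  exact hd'

lemma absolutelyContinuous_sum {α : Type*} {g : α → ℝ → ℝ} {a b : ℝ} (s : Finset α)
    (h : ∀ k ∈ s, AbsolutelyContinuousOnInterval (g k) a b) :
    AbsolutelyContinuousOnInterval (fun t => ∑ k ∈ s, g k t) a b := by
  classical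
  induction s using Finset.induction_on with
  | empty =>
    simp only [Finset.sum_empty]
    exact (LipschitzWith.const (0 : ℝ)).lipschitzOnWith.absolutelyContinuousOnInterval
  | insert k s hk ih =>
    simp only [Finset.sum_insert hk]
    exact (h k (Finset.mem_insert_self k s)).fun_add
      (ih fun j hj => h j (Finset.mem_insert_of_mem hj))

lemma absolutelyContinuous_congr {f g : ℝ → ℝ} {a b : ℝ}
    (hf : AbsolutelyContinuousOnInterval f a b) (h : EqOn f g (uIcc a b)) :
    AbsolutelyContinuousOnInterval g a b := by
  rw [absolutelyContinuousOnInterval_iff] at hf ⊢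
  intro ε hε
  obtain ⟨δ, hδ, H⟩ := hf ε hε
  refine ⟨δ, hδ, fun E hE hEδ => ?_⟩
  convert H E hE hEδ using 1
  refine Finset.sum_congr rfl fun k hk => ?_
  rw [h (hE.1 k hk).1, h (hE.1 k hk).2]

end AbsolutelyContinuous

/-! ### The closed loop in coordinates -/

/-- Names of the scalar components of the closed-loop state. -/
inductive Coord
  | x | y | θ
  | ut (i : Fin 2) | ψt (i : Fin 2) | s (i : Fin 2)
  | θr (i : Fin 2) (k : Fin 5) | θu (i : Fin 2) (k : Fin 5)
  | v (i : Fin 2)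
  deriving Fintype

/-- The components of a state. -/
def State.coord (z : State) : Coord → ℝ
  | .x => z.x
  | .y => z.y
  | .θ => z.θ
  | .ut i => z.ut i
  | .ψt i => z.ψt i
  | .s i => z.s i
  | .θr i k => z.θr i k
  | .θu i k => z.θu i k
  | .v i => z.v i

/-- The state with given components. -/
def State.ofCoord (w : Coord → ℝ) : State where
  x := w .x
  y := w .y
  θ := w .θ
  ut i := w (.ut i)
  ψt i := w (.ψt i)
  s i := w (.s i)
  θr i k := w (.θr i k)
  θu i k := w (.θu i k)
  v i := w (.v i)

@[simp] lemma State.ofCoord_coord (z : State) : State.ofCoord z.coord = z := rfl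

@[simp] lemma State.coord_ofCoord (w : Coord → ℝ) : (State.ofCoord w).coord = w := by
  funext c
  cases c <;> rfl

lemma aCOn_iff {z : ℝ → State} {a b : ℝ} :
    Setup.ACOn z a b ↔ ∀ c, AbsolutelyContinuousOnInterval (fun τ => (z τ).coord c) a b := by
  constructor
  · intro h c
    cases c with
    | x => exact h.x
    | y => exact h.y
    | θ => exact h.θ
    | ut i => exact h.ut i
    | ψt i => exact h.ψt i
    | s i => exact h.s i
    | θr i k => exact h.θr i k
    | θu i k => exact h.θu i k
    | v i => exact h.v i
  · intro h
    exact ⟨h .x, h .y, h .θ, fun i => h (.ut i), fun i => h (.ψt i), fun i => h (.s i),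
      fun i k => h (.θr i k), fun i k => h (.θu i k), fun i => h (.v i)⟩

namespace Setup

variable (S : Setup)

/-- The part of the closed-loop vector field without the sign functions. -/
noncomputable def drift (t : ℝ) (z : State) : Coord → ℝ
  | .x => S.xdot t z
  | .y => S.ydot t z
  | .θ => S.θdot t z
  | .ut i => -((S.vessel i).d11 / (S.vessel i).m11 + (S.gains i).ku) * z.ut i
      - ∑ k, (S.vessel i).φu (S.u t z i) (S.yawRate t z i) (S.ψ t z i) k * z.θu i k
  | .ψt i => -(S.gains i).lam * z.ψt i + z.s i
  | .s i => -(S.gains i).kψ * z.ψt i - (S.gains i).kr * z.s i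
      - ∑ k, (S.vessel i).φr (S.u t z i) (z.v i) (S.yawRate t z i) (S.ψ t z i) k * z.θr i k
  | .θr i k => (S.gains i).γr
      * (S.vessel i).φr (S.u t z i) (z.v i) (S.yawRate t z i) (S.ψ t z i) k * z.s i
  | .θu i k => (S.gains i).γu
      * (S.vessel i).φu (S.u t z i) (S.yawRate t z i) (S.ψ t z i) k * z.ut i
  | .v i => S.vdot t z i (S.yawRate t z i)

/-- The gain of the sign function in each component of the closed-loop vector field. -/
noncomputable def signGain : Coord → ℝ
  | .ut i => (S.gains i).ke
  | .s i => (S.gains i).kd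
  | _ => 0

lemma signGain_nonneg (c : Coord) : 0 ≤ S.signGain c := by
  cases c <;> simp only [signGain, le_refl]
  · exact (S.gains _).ke_pos.le
  · exact (S.gains _).kd_pos.le

lemma closedLoopAt_iff {z : ℝ → State} {t : ℝ} :
    S.ClosedLoopAt z t ↔ ∀ c, ∃ σ ∈ Sgn ((z t).coord c),
      HasDerivAt (fun τ => (z τ).coord c) (S.drift t (z t) c - S.signGain c * σ) t := by
  constructor
  · intro h c
    have key : S.signGain c = 0 → HasDerivAt (fun τ => (z τ).coord c) (S.drift t (z t) c) t →
        ∃ σ ∈ Sgn ((z t).coord c),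
          HasDerivAt (fun τ => (z τ).coord c) (S.drift t (z t) c - S.signGain c * σ) t :=
      fun hc h => ⟨_, sign_mem_Sgn, by simpa [hc] using h⟩
    cases c with
    | ut i => exact h.ut i
    | s i => exact h.s i
    | x => exact key rfl h.x
    | y => exact key rfl h.y
    | θ => exact key rfl h.θ
    | ψt i => exact key rfl (h.ψt i)
    | θr i k => exact key rfl (h.θr i k)
    | θu i k => exact key rfl (h.θu i k)
    | v i => exact key rfl (h.v i)
  · intro h
    have key : ∀ c, S.signGain c = 0 →
        HasDerivAt (fun τ => (z τ).coord c) (S.drift t (z t) c) t := by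
      intro c hc
      obtain ⟨σ, -, hσ⟩ := h c
      simpa [hc] using hσ
    exact ⟨key .x rfl, key .y rfl, key .θ rfl, fun i => h (.ut i), fun i => key (.ψt i) rfl,
      fun i => h (.s i), fun i k => key (.θr i k) rfl, fun i k => key (.θu i k) rfl,
      fun i => key (.v i) rfl⟩

/-! ### Continuity of the closed-loop vector field -/

lemma Δ_pos (z : State) : 0 < S.Δ z :=
  Real.sqrt_pos.2 (by have := S.μ_pos; positivity)

lemma Ud_sq_pos (t : ℝ) (z : State) (i : Fin 2) : 0 < S.ud i t ^ 2 + z.v i ^ 2 := by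
  have := S.ud_pos i t
  positivity

@[fun_prop] lemma continuous_ud (i : Fin 2) : Continuous (S.ud i) := (S.ud_contDiff i).continuous

@[fun_prop] lemma continuous_deriv_ud (i : Fin 2) : Continuous (deriv (S.ud i)) :=
  (S.ud_contDiff i).continuous_deriv le_rfl

@[fun_prop] lemma continuous_γ : Continuous S.path.γ := S.path.γ_smooth.continuous

@[fun_prop] lemma continuous_κ : Continuous S.path.κ :=
  S.path.γ_smooth.continuous_deriv (by exact_mod_cast le_top)

/-- The update law of the path variable without the course, whose polar angle is discontinuous. -/
lemma θdot_eq (t : ℝ) (z : State) : S.θdot t z =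
    1 / 2 * (S.u t z 0 * Real.cos (S.ψ t z 0 - S.γp z) - z.v 0 * Real.sin (S.ψ t z 0 - S.γp z))
    + 1 / 2 * (S.u t z 1 * Real.cos (S.ψ t z 1 - S.γp z) - z.v 1 * Real.sin (S.ψ t z 1 - S.γp z))
    + S.kθ * (z.x / √(1 + z.x ^ 2)) := by
  rw [θdot, ← S.U_mul_cos, ← S.U_mul_cos]
  ring

section Continuity

variable (i : Fin 2)

/-- The value of a function of time and state, in coordinates. -/
abbrev inCoords (f : ℝ → State → ℝ) (q : ℝ × (Coord → ℝ)) : ℝ := f q.1 (State.ofCoord q.2)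

lemma continuous_coords (c : Coord) : Continuous fun q : ℝ × (Coord → ℝ) => q.2 c := by fun_prop

lemma continuous_Δ : Continuous (inCoords fun _ z => S.Δ z) := by
  simp only [Δ]
  fun_prop

lemma continuous_Ud : Continuous (inCoords fun t z => S.Ud t z i) := by
  simp only [Ud]
  fun_prop

lemma continuous_u : Continuous (inCoords fun t z => S.u t z i) := by
  simp only [u]
  fun_prop

lemma continuous_γp : Continuous (inCoords fun _ z => S.γp z) := by
  simp only [γp]
  fun_prop

lemma continuous_κp : Continuous (inCoords fun _ z => S.κp z) := by
  simp only [κp]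
  fun_prop

lemma continuous_div_Δ : Continuous (inCoords fun _ z => z.y / S.Δ z) :=
  (continuous_coords .y).div S.continuous_Δ fun _ => (S.Δ_pos _).ne'

lemma continuous_ψ : Continuous (inCoords fun t z => S.ψ t z i) := by
  refine Continuous.add (Continuous.sub (S.continuous_γp.sub
    (Real.continuous_arctan.comp S.continuous_div_Δ)) (Real.continuous_arctan.comp
    ((continuous_coords (.v i)).div ((S.continuous_ud i).comp continuous_fst)
      fun q => (S.ud_pos i q.1).ne'))) (continuous_coords (.ψt i))

lemma continuous_uc : Continuous (inCoords fun t z => S.uc t z i) := by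
  have := S.continuous_ψ i
  simp only [uc] at this ⊢
  fun_prop

lemma continuous_vc : Continuous (inCoords fun t z => S.vc t z i) := by
  have := S.continuous_ψ i
  simp only [vc] at this ⊢
  fun_prop

lemma continuous_X : Continuous
    (inCoords fun t z => (S.vessel i).X (S.u t z i) (S.uc t z i)) := by
  have h1 := S.continuous_u i
  have h2 := S.continuous_uc i
  simp only [Vessel.X] at h1 h2 ⊢
  fun_prop

lemma continuous_Y : Continuous
    (inCoords fun t z => (S.vessel i).Y (S.u t z i) (S.uc t z i)) := by
  have h1 := S.continuous_u i
  have h2 := S.continuous_uc i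
  simp only [Vessel.Y] at h1 h2 ⊢
  fun_prop

lemma continuous_θdot : Continuous (inCoords S.θdot) := by
  have hu0 := S.continuous_u 0
  have hu1 := S.continuous_u 1
  have hψ0 := S.continuous_ψ 0
  have hψ1 := S.continuous_ψ 1
  have hγ := S.continuous_γp
  have hx : Continuous fun q : ℝ × (Coord → ℝ) => q.2 .x / √(1 + q.2 .x ^ 2) :=
    (continuous_coords .x).div (by fun_prop) fun q => by positivity
  unfold inCoords at *
  simp only [θdot_eq, State.ofCoord] at hu0 hu1 hψ0 hψ1 hγ hx ⊢
  fun_prop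

lemma continuous_xdot : Continuous (inCoords S.xdot) := by
  have hx : Continuous fun q : ℝ × (Coord → ℝ) => q.2 .x / √(1 + q.2 .x ^ 2) :=
    (continuous_coords .x).div (by fun_prop) fun q => by positivity
  have h1 := S.continuous_θdot
  have h2 := S.continuous_κp
  unfold inCoords at *
  simp only [xdot, State.ofCoord] at hx h1 h2 ⊢
  fun_prop

lemma continuous_G1 : Continuous (inCoords S.G1) := by
  have hu := S.continuous_Ud
  have hψ := S.continuous_ψ
  have hγ := S.continuous_γp
  have hΔ := S.continuous_div_Δ
  unfold inCoords at *
  simp only [G1, G2, State.ofCoord] at hu hψ hγ hΔ ⊢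
  fun_prop

lemma continuous_ydot : Continuous (inCoords S.ydot) := by
  have h0 := S.continuous_Ud
  have h1 := S.continuous_θdot
  have h2 := S.continuous_κp
  have h3 := S.continuous_G1
  have h4 := S.continuous_Δ
  refine Continuous.add (Continuous.sub (Continuous.div ?_ ?_ fun q => ?_) ?_) h3
  · simp only [State.ofCoord] at h0 ⊢
    fun_prop
  · simp only [State.ofCoord] at h4 ⊢
    fun_prop
  · have := S.Δ_pos (State.ofCoord q.2)
    positivity
  · simp only [State.ofCoord] at h1 h2 ⊢
    fun_prop

lemma continuous_yawCoeff : Continuous (inCoords fun t z => S.yawCoeff t z i) := by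
  have h1 := S.continuous_X i
  refine continuous_const.add (Continuous.div ?_ ?_ fun q => (S.Ud_sq_pos q.1 _ i).ne')
  · simp only [State.ofCoord] at h1 ⊢
    fun_prop
  · simp only [State.ofCoord]
    fun_prop

lemma continuous_rd_zero : Continuous (inCoords fun t z => S.rd t z i 0) := by
  have h1 := S.continuous_θdot
  have h2 := S.continuous_κp
  have h3 := S.continuous_Y i
  have h4 := S.continuous_Δ
  have h5 := S.continuous_xdot
  have h6 := S.continuous_ydot
  have h7 := S.continuous_vc i
  have hΔ : ∀ z, 0 < S.Δ z ^ 2 + z.y ^ 2 := fun z => by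
    have := S.Δ_pos z
    positivity
  have hx : Continuous (inCoords fun _ z => z.x / S.Δ z) :=
    (continuous_coords .x).div h4 fun _ => (S.Δ_pos _).ne'
  have hy := S.continuous_div_Δ
  refine Continuous.sub (Continuous.sub (h2.mul h1) (Continuous.div ?_ ?_ fun q =>
    (S.Ud_sq_pos q.1 _ i).ne')) (Continuous.mul (continuous_const.div ?_ fun q => (hΔ _).ne') ?_)
  · simp only [vdot, mul_zero, zero_add, State.ofCoord] at h3 h7 ⊢
    fun_prop
  · simp only [State.ofCoord]
    fun_prop
  · simp only [State.ofCoord] at h4 ⊢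
    fun_prop
  · simp only [State.ofCoord] at h4 h5 h6 hx hy ⊢
    fun_prop

/-- The domain of the closed-loop vector field, in coordinates. -/
def coordDomain : Set (ℝ × (Coord → ℝ)) :=
  {q | ∀ i, S.yawCoeff q.1 (State.ofCoord q.2) i ≠ 0}

lemma isOpen_coordDomain : IsOpen S.coordDomain := by
  simp only [coordDomain, ofPred_forall]
  exact isOpen_iInter_of_finite fun i => isOpen_ne_fun (S.continuous_yawCoeff i) continuous_const

lemma continuousOn_yawRate : ContinuousOn (inCoords fun t z => S.yawRate t z i) S.coordDomain := by
  refine ContinuousOn.div (Continuous.continuousOn ((S.continuous_rd_zero i).add ?_))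
    (S.continuous_yawCoeff i).continuousOn fun q hq => hq i
  simp only [rt, State.ofCoord]
  fun_prop

lemma continuousOn_drift : ContinuousOn
    (fun q : ℝ × (Coord → ℝ) => S.drift q.1 (State.ofCoord q.2)) S.coordDomain := by
  refine continuousOn_pi.2 fun c => ?_
  have hr := S.continuousOn_yawRate
  have hu := fun i => (S.continuous_u i).continuousOn (s := S.coordDomain)
  have hψ := fun i => (S.continuous_ψ i).continuousOn (s := S.coordDomain)
  have hX := fun i => (S.continuous_X i).continuousOn (s := S.coordDomain)
  have hY := fun i => (S.continuous_Y i).continuousOn (s := S.coordDomain)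
  have hvc := fun i => (S.continuous_vc i).continuousOn (s := S.coordDomain)
  have hφu : ∀ i k, ContinuousOn (inCoords fun t z =>
      (S.vessel i).φu (S.u t z i) (S.yawRate t z i) (S.ψ t z i) k) S.coordDomain := by
    intro i k
    have h1 := hr i
    have h2 := hu i
    have h3 := hψ i
    fin_cases k <;> simp [Vessel.φu] at h1 h2 h3 ⊢ <;> fun_prop
  have hφr : ∀ i k, ContinuousOn (inCoords fun t z =>
      (S.vessel i).φr (S.u t z i) (z.v i) (S.yawRate t z i) (S.ψ t z i) k) S.coordDomain := by
    intro i k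
    have h1 := hr i
    have h2 := hu i
    have h3 := hψ i
    have h4 := continuous_coords (.v i)
    fin_cases k <;>
      simp [Vessel.φr, Vessel.a1, Vessel.a2] at h1 h2 h3 h4 ⊢ <;> fun_prop
  cases c with
  | x => exact S.continuous_xdot.continuousOn
  | y => exact S.continuous_ydot.continuousOn
  | θ => exact S.continuous_θdot.continuousOn
  | ut i =>
    have h := hφu i
    simp only [drift, State.ofCoord] at h ⊢
    fun_prop
  | ψt i =>
    simp only [drift, State.ofCoord]
    fun_prop
  | s i =>
    have h := hφr i
    simp only [drift, State.ofCoord] at h ⊢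
    fun_prop
  | θr i k =>
    have h := hφr i k
    simp only [drift, State.ofCoord] at h ⊢
    fun_prop
  | θu i k =>
    have h := hφu i k
    simp only [drift, State.ofCoord] at h ⊢
    fun_prop
  | v i =>
    have h1 := hr i
    have h2 := hX i
    have h3 := hY i
    have h4 := hvc i
    simp only [drift, vdot, State.ofCoord] at h1 h2 h3 h4 ⊢
    fun_prop

end Continuity

/-! ### Maximal trajectories -/

lemma ClosedLoopAt.congr {S : Setup} {z z' : ℝ → State} {t : ℝ} (h : S.ClosedLoopAt z t)
    (hz : z' =ᶠ[𝓝 t] z) : S.ClosedLoopAt z' t := by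
  rw [closedLoopAt_iff] at h ⊢
  rw [hz.eq_of_nhds]
  intro c
  obtain ⟨σ, hσ, hd⟩ := h c
  exact ⟨σ, hσ, hd.congr_of_eventuallyEq (hz.fun_comp fun s => s.coord c)⟩

lemma mem_timeInterval_coe {t₀ T t : ℝ} : t ∈ timeInterval t₀ (T : EReal) ↔ t ∈ Ico t₀ T := by
  simp [timeInterval]

lemma aCOn_of_lipschitz {w : ℝ → Coord → ℝ} {K : NNReal} {a b : ℝ} (hab : a ≤ b)
    (h : LipschitzOnWith K w (Icc a b)) : ACOn (fun t => State.ofCoord (w t)) a b := by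
  refine aCOn_iff.2 fun c => LipschitzOnWith.absolutelyContinuousOnInterval (K := K) ?_
  rw [uIcc_of_le hab]
  refine LipschitzOnWith.of_dist_le_mul fun s hs t ht => ?_
  simp only [State.coord_ofCoord]
  exact (dist_le_pi_dist (w s) (w t) c).trans (h.dist_le_mul s hs t ht)

/-- Local existence of trajectories, in coordinates. -/
lemma exists_local {t₀ : ℝ} {w₀ : Coord → ℝ} (h₀ : (t₀, w₀) ∈ S.coordDomain) :
    ∃ δ > 0, ∃ K : NNReal, ∃ w : ℝ → Coord → ℝ, w t₀ = w₀ ∧ LipschitzOnWith K w (Ici t₀) ∧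
      (∀ t ∈ Icc t₀ (t₀ + δ), (t, w t) ∈ S.coordDomain) ∧
      ∀ᵐ t : ℝ, t ∈ Ioo t₀ (t₀ + δ) → S.ClosedLoopAt (fun t => State.ofCoord (w t)) t := by
  obtain ⟨δ, hδ, K, w, hw0, hwK, hwD, hw⟩ :=
    exists_local_filippov S.signGain_nonneg S.isOpen_coordDomain
      (f := fun t w => S.drift t (State.ofCoord w)) S.continuousOn_drift h₀
  refine ⟨δ, hδ, K, w, hw0, hwK, hwD, ?_⟩
  filter_upwards [hw] with t ht htI
  rw [closedLoopAt_iff]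
  simpa only [State.coord_ofCoord] using ht htI

lemma exists_isTrajectory {t₀ : ℝ} {z₀ : State} (h₀ : ∀ i, S.yawCoeff t₀ z₀ i ≠ 0) :
    ∃ (T : EReal) (z : ℝ → State), S.IsTrajectory t₀ T z ∧ z t₀ = z₀ := by
  obtain ⟨δ, hδ, K, w, hw0, hwK, hwD, hw⟩ := S.exists_local (t₀ := t₀) (w₀ := z₀.coord) h₀
  refine ⟨((t₀ + δ : ℝ) : EReal), fun t => State.ofCoord (w t), ⟨?_, fun b hb => ?_,
    fun t ht i => ?_, ?_⟩, by simp [hw0]⟩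
  · exact_mod_cast lt_add_of_pos_right t₀ hδ
  · rw [mem_timeInterval_coe] at hb
    exact aCOn_of_lipschitz hb.1 (hwK.mono Icc_subset_Ici_self)
  · rw [mem_timeInterval_coe] at ht
    exact hwD t (Ico_subset_Icc_self ht) i
  · have hne : ∀ᵐ t : ℝ, t ≠ t₀ := by simp [ae_iff, measure_singleton]
    filter_upwards [hw, hne] with t ht htne htI
    rw [mem_timeInterval_coe] at htI
    exact ht ⟨lt_of_le_of_ne htI.1 htne.symm, htI.2⟩

/-- A trajectory on a bounded time interval that is Lipschitz and along which the yaw rate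
coefficients are bounded away from zero extends to a longer time interval. -/
lemma IsTrajectory.exists_extension {S : Setup} {t₀ T : ℝ} {z : ℝ → State}
    (hz : S.IsTrajectory t₀ T z) {K : NNReal}
    (hK : LipschitzOnWith K (fun t => (z t).coord) (Ico t₀ T)) {c : ℝ} (hc : 0 < c)
    (hyaw : ∀ t ∈ Ico t₀ T, ∀ i, c ≤ |S.yawCoeff t (z t) i|) :
    ∃ (T' : EReal) (z' : ℝ → State), (T : EReal) < T' ∧ S.IsTrajectory t₀ T' z' ∧
      EqOn z' z (Ico t₀ T) := by
  have hT : t₀ < T := by exact_mod_cast hz.lt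
  obtain ⟨g, hgK, hg⟩ := hK.extend_pi
  have hgz : ∀ t ∈ Ico t₀ T, State.ofCoord (g t) = z t := fun t ht => by
    rw [← hg ht, State.ofCoord_coord]
  have hD : (T, g T) ∈ S.coordDomain := by
    intro i
    have hcont : Continuous fun t => |S.yawCoeff t (State.ofCoord (g t)) i| :=
      ((S.continuous_yawCoeff i).comp (continuous_id.prodMk hgK.continuous)).abs
    have hev : ∀ᶠ t in 𝓝[<] T, c ≤ |S.yawCoeff t (State.ofCoord (g t)) i| := by
      filter_upwards [Ico_mem_nhdsLT hT] with t ht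
      rw [hgz t ht]
      exact hyaw t ht i
    have := ge_of_tendsto (hcont.continuousAt.tendsto.mono_left nhdsWithin_le_nhds) hev
    exact abs_pos.1 (hc.trans_le this)
  obtain ⟨δ, hδ, M, y, hy0, hyM, hyD, hy⟩ := S.exists_local hD
  let w : ℝ → Coord → ℝ := fun t => if t < T then g t else y t
  have hw1 : ∀ t, t < T → w t = g t := fun t ht => if_pos ht
  have hw2 : ∀ t, T ≤ t → w t = y t := fun t ht => if_neg ht.not_gt
  have hwL : LipschitzWith (max K M) w := by
    have hmono : ∀ s t, s ≤ t → dist (w s) (w t) ≤ (max K M : NNReal) * (t - s) := by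
      intro s t hst
      have hK' : (K : ℝ) ≤ (max K M : NNReal) := NNReal.coe_le_coe.2 (le_max_left _ _)
      have hM' : (M : ℝ) ≤ (max K M : NNReal) := NNReal.coe_le_coe.2 (le_max_right _ _)
      have hgd : ∀ s t, s ≤ t → dist (g s) (g t) ≤ (max K M : NNReal) * (t - s) := fun s t hst => by
        have := hgK.dist_le_mul s t
        rw [dist_comm s t, Real.dist_eq, abs_of_nonneg (sub_nonneg.2 hst)] at this
        exact this.trans (mul_le_mul_of_nonneg_right hK' (sub_nonneg.2 hst))
      have hyd : ∀ s t, T ≤ s → s ≤ t → dist (y s) (y t) ≤ (max K M : NNReal) * (t - s) :=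
        fun s t hs hst => by
          have := hyM.dist_le_mul s hs t (hs.trans hst)
          rw [dist_comm s t, Real.dist_eq, abs_of_nonneg (sub_nonneg.2 hst)] at this
          exact this.trans (mul_le_mul_of_nonneg_right hM' (sub_nonneg.2 hst))
      rcases lt_or_ge t T with ht | ht
      · rw [hw1 t ht, hw1 s (hst.trans_lt ht)]
        exact hgd s t hst
      · rw [hw2 t ht]
        rcases lt_or_ge s T with hs | hs
        · rw [hw1 s hs]
          have h1 := hgd s T hs.le
          have h2 := hyd T t le_rfl ht
          rw [hy0] at h2
          have := dist_triangle (g s) (g T) (y t)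
          linarith
        · rw [hw2 s hs]
          exact hyd s t hs hst
    refine LipschitzWith.of_dist_le_mul fun s t => ?_
    rcases le_total s t with hst | hst
    · rw [dist_comm s t, Real.dist_eq, abs_of_nonneg (sub_nonneg.2 hst)]
      exact hmono s t hst
    · rw [dist_comm (w s), Real.dist_eq, abs_of_nonneg (sub_nonneg.2 hst)]
      exact hmono t s hst
  have hwz : ∀ t ∈ Ico t₀ T, State.ofCoord (w t) = z t := fun t ht => by
    rw [hw1 t ht.2, hgz t ht]
  refine ⟨((T + δ : ℝ) : EReal), fun t => State.ofCoord (w t), by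
    exact_mod_cast lt_add_of_pos_right T hδ, ⟨?_, fun b hb => ?_, fun t ht i => ?_, ?_⟩, hwz⟩
  · exact_mod_cast hT.trans (lt_add_of_pos_right T hδ)
  · exact aCOn_of_lipschitz hb.1 hwL.lipschitzOnWith
  · rw [mem_timeInterval_coe] at ht
    rcases lt_or_ge t T with htT | htT
    · rw [hwz t ⟨ht.1, htT⟩]
      exact hz.domain t (mem_timeInterval_coe.2 ⟨ht.1, htT⟩) i
    · rw [hw2 t htT]
      exact hyD t ⟨htT, ht.2.le⟩ i
  · have hne : ∀ a : ℝ, ∀ᵐ t : ℝ, t ≠ a := fun a => by simp [ae_iff, measure_singleton]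
    filter_upwards [hz.eqn, hy, hne t₀, hne T] with t h1 h2 h3 h4 ht
    rw [mem_timeInterval_coe] at ht
    rcases lt_or_gt_of_ne h4 with htT | htT
    · refine (h1 (mem_timeInterval_coe.2 ⟨ht.1, htT⟩)).congr ?_
      filter_upwards [Ioo_mem_nhds (lt_of_le_of_ne ht.1 h3.symm) htT] with s hs
      exact hwz s ⟨hs.1.le, hs.2⟩
    · refine (h2 ⟨htT, ht.2⟩).congr ?_
      filter_upwards [Ioi_mem_nhds htT] with s hs
      rw [hw2 s (le_of_lt hs)]

/-- Trajectories that agree wherever two of them are defined have a common extension. -/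
lemma exists_isTrajectory_sSup {t₀ : ℝ} {z₀ : State} {c : Set (EReal × (ℝ → State))}
    (hc : c.Nonempty) (htraj : ∀ p ∈ c, S.IsTrajectory t₀ p.1 p.2 ∧ p.2 t₀ = z₀)
    (hcomp : ∀ p ∈ c, ∀ q ∈ c, ∀ t ∈ timeInterval t₀ p.1, t ∈ timeInterval t₀ q.1 →
      p.2 t = q.2 t) :
    ∃ z : ℝ → State, S.IsTrajectory t₀ (sSup (Prod.fst '' c)) z ∧ z t₀ = z₀ ∧
      ∀ p ∈ c, EqOn p.2 z (timeInterval t₀ p.1) := by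
  classical
  let z : ℝ → State := fun t =>
    if h : ∃ p ∈ c, t ∈ timeInterval t₀ p.1 then h.choose.2 t else z₀
  have hzp : ∀ p ∈ c, EqOn p.2 z (timeInterval t₀ p.1) := by
    intro p hp t ht
    have h : ∃ p ∈ c, t ∈ timeInterval t₀ p.1 := ⟨p, hp, ht⟩
    simp only [z, dif_pos h]
    exact hcomp p hp _ h.choose_spec.1 t ht h.choose_spec.2
  have hex : ∀ t ∈ timeInterval t₀ (sSup (Prod.fst '' c)), ∃ p ∈ c, (t : EReal) < p.1 := by
    intro t ht
    obtain ⟨_, ⟨p, hp, rfl⟩, h⟩ := lt_sSup_iff.1 ht.2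
    exact ⟨p, hp, h⟩
  obtain ⟨p₀, hp₀⟩ := hc
  refine ⟨z, ⟨(htraj p₀ hp₀).1.lt.trans_le (le_sSup ⟨p₀, hp₀, rfl⟩), fun b hb => ?_,
    fun t ht i => ?_, ?_⟩, ?_, hzp⟩
  · obtain ⟨p, hp, hbp⟩ := hex b hb
    refine aCOn_iff.2 fun k => ?_
    refine absolutelyContinuous_congr ((aCOn_iff.1 ((htraj p hp).1.ac b ⟨hb.1, hbp⟩)) k)
      fun t ht => ?_
    rw [uIcc_of_le hb.1] at ht
    simp only [hzp p hp ⟨ht.1, (EReal.coe_le_coe_iff.2 ht.2).trans_lt hbp⟩]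
  · obtain ⟨p, hp, htp⟩ := hex t ht
    rw [← hzp p hp ⟨ht.1, htp⟩]
    exact (htraj p hp).1.domain t ⟨ht.1, htp⟩ i
  · -- The chain may be uncountable; rational end times reduce the exceptional null sets to
    -- countably many.
    have hrat : ∀ᵐ t : ℝ, ∀ q : ℚ, ((q : ℝ) : EReal) < sSup (Prod.fst '' c) → t₀ < t → t < q →
        S.ClosedLoopAt z t := by
      refine ae_all_iff.2 fun q => ?_
      by_cases hq : ((q : ℝ) : EReal) < sSup (Prod.fst '' c)
      · obtain ⟨_, ⟨p, hp, rfl⟩, hqp⟩ := lt_sSup_iff.1 hq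
        filter_upwards [(htraj p hp).1.eqn] with t ht _ ht0 htq
        have hlt : ∀ s : ℝ, s < q → (s : EReal) < p.1 := fun s hs =>
          (EReal.coe_lt_coe_iff.2 hs).trans hqp
        refine (ht ⟨ht0.le, hlt t htq⟩).congr ?_
        filter_upwards [Ioo_mem_nhds ht0 htq] with s hs
        exact (hzp p hp ⟨hs.1.le, hlt s hs.2⟩).symm
      · exact Eventually.of_forall fun t h => absurd h hq
    have hne : ∀ᵐ t : ℝ, t ≠ t₀ := by simp [ae_iff, measure_singleton]
    filter_upwards [hrat, hne] with t ht htne htI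
    obtain ⟨q, hq1, hq2⟩ := EReal.lt_iff_exists_rat_btwn.1 htI.2
    exact ht q hq2 (lt_of_le_of_ne htI.1 htne.symm) (EReal.coe_lt_coe_iff.1 hq1)
  · rw [← hzp p₀ hp₀ ⟨le_rfl, (htraj p₀ hp₀).1.lt⟩]
    exact (htraj p₀ hp₀).2

theorem exists_isMaximalTrajectory {t₀ : ℝ} {z₀ : State} (h₀ : ∀ i, S.yawCoeff t₀ z₀ i ≠ 0) :
    ∃ (T : EReal) (z : ℝ → State), S.IsMaximalTrajectory t₀ T z ∧ z t₀ = z₀ := by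
  let α := {p : EReal × (ℝ → State) // S.IsTrajectory t₀ p.1 p.2 ∧ p.2 t₀ = z₀}
  let r : α → α → Prop := fun p q =>
    p.1.1 ≤ q.1.1 ∧ EqOn p.1.2 q.1.2 (timeInterval t₀ p.1.1)
  have hmono : ∀ {T T' : EReal}, T ≤ T' → timeInterval t₀ T ⊆ timeInterval t₀ T' :=
    fun h t ht => ⟨ht.1, ht.2.trans_le h⟩
  obtain ⟨⟨⟨T, z⟩, hz, hz0⟩, hm⟩ : ∃ m : α, ∀ a, r m a → r a m := by
    refine exists_maximal_of_chains_bounded (fun c hc => ?_) fun {a b c} hab hbc =>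
      ⟨hab.1.trans hbc.1, hab.2.trans (hbc.2.mono (hmono hab.1))⟩
    rcases c.eq_empty_or_nonempty with rfl | hne
    · obtain ⟨T, z, hz⟩ := S.exists_isTrajectory h₀
      exact ⟨⟨(T, z), hz⟩, by simp⟩
    · obtain ⟨z, hz, hz0, hzc⟩ := S.exists_isTrajectory_sSup (t₀ := t₀) (z₀ := z₀)
        (c := Subtype.val '' c) (hne.image _) (by rintro _ ⟨p, -, rfl⟩; exact p.2) (by
          rintro _ ⟨p, hp, rfl⟩ _ ⟨q, hq, rfl⟩ t htp htq
          by_cases hpq : p = q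
          · rw [hpq]
          · rcases hc hp hq hpq with h | h
            · exact h.2 htp
            · exact (h.2 htq).symm)
      refine ⟨⟨(_, z), hz, hz0⟩, fun p hp => ⟨le_sSup ⟨p.1, ⟨p, hp, rfl⟩, rfl⟩, ?_⟩⟩
      exact hzc p.1 ⟨p, hp, rfl⟩
  refine ⟨T, z, ⟨hz, fun T' z' hz' heq => ?_⟩, hz0⟩
  by_contra hlt
  rw [not_le] at hlt
  rw [inter_eq_left.2 (hmono hlt.le)] at heq
  have hz'0 : z' t₀ = z₀ := by rw [heq ⟨le_rfl, hz.lt⟩]; exact hz0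
  exact hlt.not_ge (hm ⟨(T', z'), hz', hz'0⟩ ⟨hlt.le, heq.symm⟩).1

end Setup

/-! ### Linear growth of the closed-loop vector field -/

namespace Setup
open Asymptotics

/-- Along the filter `l` of times and states, the autopilot errors, the curvature of the path, all
continuous functions of time, and the reciprocals of the yaw rate coefficients are bounded. -/
structure Controlled (S : Setup) (l : Filter (ℝ × State)) : Prop where
  time : ∀ f : ℝ → ℝ, Continuous f → (fun p => f p.1) =O[l] fun _ => (1 : ℝ)
  ut : ∀ i, (fun p => p.2.ut i) =O[l] fun _ => (1 : ℝ)
  ψt : ∀ i, (fun p => p.2.ψt i) =O[l] fun _ => (1 : ℝ)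
  s : ∀ i, (fun p => p.2.s i) =O[l] fun _ => (1 : ℝ)
  κ : (fun p => S.κp p.2) =O[l] fun _ => (1 : ℝ)
  yaw : ∀ i, (fun p => (S.yawCoeff p.1 p.2 i)⁻¹) =O[l] fun _ => (1 : ℝ)

/-- The size of the sway velocities, against which the closed-loop vector field is measured. -/
noncomputable def swaySize (p : ℝ × State) : ℝ := 1 + |p.2.v 0| + |p.2.v 1|

lemma one_le_swaySize (p : ℝ × State) : 1 ≤ swaySize p := by
  unfold swaySize
  have := abs_nonneg (p.2.v 0)
  have := abs_nonneg (p.2.v 1)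
  linarith

lemma isBigO_of_abs_le {l : Filter (ℝ × State)} {f g : ℝ × State → ℝ} (h : ∀ p, |f p| ≤ g p) :
    f =O[l] g :=
  IsBigO.of_bound' (Eventually.of_forall fun p => (h p).trans (le_abs_self _))

lemma isBigO_mul_bounded {l : Filter (ℝ × State)} {f g k : ℝ × State → ℝ}
    (hf : f =O[l] fun _ => (1 : ℝ)) (hg : g =O[l] k) : (fun p => f p * g p) =O[l] k := by
  simpa using hf.mul hg

lemma one_isBigO_swaySize {l : Filter (ℝ × State)} : (fun _ => (1 : ℝ)) =O[l] swaySize :=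
  isBigO_of_abs_le fun p => by simpa using one_le_swaySize p

lemma v_isBigO {l : Filter (ℝ × State)} (i : Fin 2) : (fun p => p.2.v i) =O[l] swaySize :=
  isBigO_of_abs_le fun p => by
    have := abs_nonneg (p.2.v 0)
    have := abs_nonneg (p.2.v 1)
    unfold swaySize
    fin_cases i <;> simp only [Fin.zero_eta, Fin.mk_one] <;> linarith

lemma cos_isBigO {l : Filter (ℝ × State)} (f : ℝ × State → ℝ) :
    (fun p => Real.cos (f p)) =O[l] fun _ => (1 : ℝ) :=
  isBigO_of_abs_le fun _ => Real.abs_cos_le_one _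

lemma sin_isBigO {l : Filter (ℝ × State)} (f : ℝ × State → ℝ) :
    (fun p => Real.sin (f p)) =O[l] fun _ => (1 : ℝ) :=
  isBigO_of_abs_le fun _ => Real.abs_sin_le_one _

lemma abs_div_sqrt_le_one (x : ℝ) : |x / √(1 + x ^ 2)| ≤ 1 := by
  rw [abs_div, abs_of_nonneg (Real.sqrt_nonneg _)]
  exact div_le_one_of_le₀ (Real.abs_le_sqrt (by linarith)) (Real.sqrt_nonneg _)

lemma x_isBigO_Δ (S : Setup) {l : Filter (ℝ × State)} : (fun p => p.2.x) =O[l] fun p => S.Δ p.2 :=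
  isBigO_of_abs_le fun p => Real.abs_le_sqrt (by have := S.μ_pos; nlinarith [sq_nonneg p.2.y])

lemma y_isBigO_Δ (S : Setup) {l : Filter (ℝ × State)} : (fun p => p.2.y) =O[l] fun p => S.Δ p.2 :=
  isBigO_of_abs_le fun p => Real.abs_le_sqrt (by have := S.μ_pos; nlinarith [sq_nonneg p.2.x])

lemma one_isBigO_Δ (S : Setup) {l : Filter (ℝ × State)} :
    (fun _ => (1 : ℝ)) =O[l] fun p => S.Δ p.2 := by
  have hμ : 0 < √S.μ := Real.sqrt_pos.2 S.μ_pos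
  refine IsBigO.of_bound (√S.μ)⁻¹ (Eventually.of_forall fun p => ?_)
  rw [norm_one, Real.norm_of_nonneg (S.Δ_pos _).le, inv_mul_eq_div, le_div_iff₀ hμ, one_mul]
  exact Real.sqrt_le_sqrt (by nlinarith [sq_nonneg p.2.x, sq_nonneg p.2.y])

lemma div_Δ_isBigO (S : Setup) {l : Filter (ℝ × State)} {f g : ℝ × State → ℝ}
    (h : f =O[l] fun p => g p * S.Δ p.2) : (fun p => f p / S.Δ p.2) =O[l] g := by
  have := h.mul (isBigO_refl (fun p : ℝ × State => (S.Δ p.2)⁻¹) l)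
  refine this.congr_right fun p => ?_
  have := (S.Δ_pos p.2).ne'
  field_simp

namespace Controlled

variable {S : Setup} {l : Filter (ℝ × State)}

lemma ud_isBigO (h : S.Controlled l) (i : Fin 2) : (fun p => S.ud i p.1) =O[l] fun _ => (1 : ℝ) :=
  h.time _ (S.continuous_ud i)

lemma u_isBigO (h : S.Controlled l) (i : Fin 2) : (fun p => S.u p.1 p.2 i) =O[l] fun _ => (1 : ℝ) :=
  (h.ud_isBigO i).add (h.ut i)

lemma uc_isBigO (S : Setup) (i : Fin 2) : (fun p => S.uc p.1 p.2 i) =O[l] fun _ => (1 : ℝ) := by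
  have h1 := (cos_isBigO (l := l) fun p => S.ψ p.1 p.2 i).mul
    (isBigO_const_const S.Vx one_ne_zero l)
  have h2 := (sin_isBigO (l := l) fun p => S.ψ p.1 p.2 i).mul
    (isBigO_const_const S.Vy one_ne_zero l)
  simpa [Setup.uc] using h1.add h2

lemma vc_isBigO (S : Setup) (i : Fin 2) : (fun p => S.vc p.1 p.2 i) =O[l] fun _ => (1 : ℝ) := by
  have h1 := (sin_isBigO (l := l) fun p => S.ψ p.1 p.2 i).neg_left.mul
    (isBigO_const_const S.Vx one_ne_zero l)
  have h2 := (cos_isBigO (l := l) fun p => S.ψ p.1 p.2 i).mul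
    (isBigO_const_const S.Vy one_ne_zero l)
  simpa [Setup.vc] using h1.add h2

lemma X_isBigO (h : S.Controlled l) (i : Fin 2) :
    (fun p => (S.vessel i).X (S.u p.1 p.2 i) (S.uc p.1 p.2 i)) =O[l] fun _ => (1 : ℝ) := by
  have c : ∀ a : ℝ, (fun _ : ℝ × State => a) =O[l] fun _ => (1 : ℝ) := fun a =>
    isBigO_const_const a one_ne_zero l
  have hu := h.u_isBigO i
  have hc := uc_isBigO (l := l) S i
  have hd := hu.sub hc
  exact isBigO_mul_bounded (c _) (((isBigO_mul_bounded (c _) (((c _).sub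
    (isBigO_mul_bounded (c _) hd)).sub (isBigO_mul_bounded (c _) hc))).add (c _)).add
    (isBigO_mul_bounded (c _) (((isBigO_mul_bounded (c _) hd).add
      (isBigO_mul_bounded (c _) hc)).add (isBigO_mul_bounded (c _) hc))))

lemma Y_isBigO (h : S.Controlled l) (i : Fin 2) :
    (fun p => (S.vessel i).Y (S.u p.1 p.2 i) (S.uc p.1 p.2 i)) =O[l] fun _ => (1 : ℝ) := by
  have c : ∀ a : ℝ, (fun _ : ℝ × State => a) =O[l] fun _ => (1 : ℝ) := fun a =>
    isBigO_const_const a one_ne_zero l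
  exact isBigO_mul_bounded (c _) ((c _).add
    (isBigO_mul_bounded (c _) ((h.u_isBigO i).sub (uc_isBigO S i))))

lemma Ud_isBigO (h : S.Controlled l) (i : Fin 2) : (fun p => S.Ud p.1 p.2 i) =O[l] swaySize := by
  have h1 : (fun p => S.Ud p.1 p.2 i) =O[l] fun p => |S.ud i p.1| + |p.2.v i| := by
    refine isBigO_of_abs_le fun p => ?_
    rw [Setup.Ud, abs_of_nonneg (Real.sqrt_nonneg _)]
    refine Real.sqrt_le_iff.2 ⟨by positivity, ?_⟩
    have := mul_nonneg (abs_nonneg (S.ud i p.1)) (abs_nonneg (p.2.v i))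
    nlinarith [sq_abs (S.ud i p.1), sq_abs (p.2.v i)]
  exact h1.trans (((h.ud_isBigO i).trans one_isBigO_swaySize).abs_left.add (v_isBigO i).abs_left)

lemma θdot_isBigO (h : S.Controlled l) : (fun p => S.θdot p.1 p.2) =O[l] swaySize := by
  have hx : (fun p : ℝ × State => p.2.x / √(1 + p.2.x ^ 2)) =O[l] fun _ => (1 : ℝ) :=
    isBigO_of_abs_le fun p => abs_div_sqrt_le_one _
  have c : ∀ a : ℝ, (fun _ : ℝ × State => a) =O[l] fun _ => (1 : ℝ) := fun a =>
    isBigO_const_const a one_ne_zero l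
  have hi : ∀ i, (fun p => S.u p.1 p.2 i * Real.cos (S.ψ p.1 p.2 i - S.γp p.2)
      - Real.sin (S.ψ p.1 p.2 i - S.γp p.2) * p.2.v i) =O[l] swaySize := fun i =>
    ((isBigO_mul_bounded (h.u_isBigO i) (cos_isBigO _)).trans one_isBigO_swaySize).sub
      (isBigO_mul_bounded (sin_isBigO _) (v_isBigO i))
  have := ((isBigO_mul_bounded (c (1 / 2)) (hi 0)).add (isBigO_mul_bounded (c (1 / 2)) (hi 1))).add
    ((isBigO_mul_bounded (c S.kθ) hx).trans one_isBigO_swaySize)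
  refine this.congr_left fun p => ?_
  rw [S.θdot_eq]
  ring

lemma G1_isBigO (h : S.Controlled l) : (fun p => S.G1 p.1 p.2) =O[l] swaySize := by
  have c : ∀ a : ℝ, (fun _ : ℝ × State => a) =O[l] fun _ => (1 : ℝ) := fun a =>
    isBigO_const_const a one_ne_zero l
  have hi : ∀ i, (fun p => S.G2 p.1 p.2 i) =O[l] swaySize := fun i => by
    have h1 := (isBigO_mul_bounded (h.ut i)
      (sin_isBigO fun p => S.ψ p.1 p.2 i - S.γp p.2)).trans one_isBigO_swaySize
    have h2 := isBigO_mul_bounded (isBigO_mul_bounded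
      (sin_isBigO fun p => Real.arctan (p.2.y / S.Δ p.2))
      ((c 1).sub (cos_isBigO fun p => p.2.ψt i))) (h.Ud_isBigO i)
    have h3 := isBigO_mul_bounded (isBigO_mul_bounded
      (cos_isBigO fun p => Real.arctan (p.2.y / S.Δ p.2))
      (sin_isBigO fun p => p.2.ψt i)) (h.Ud_isBigO i)
    refine ((h1.add h2).add h3).congr_left fun p => ?_
    rw [G2]
    ring
  have := isBigO_mul_bounded (c (1 / 2)) ((hi 0).add (hi 1))
  simpa only [Setup.G1, Fin.sum_univ_two] using this

lemma xdot_isBigO (h : S.Controlled l) :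
    (fun p => S.xdot p.1 p.2) =O[l] fun p => swaySize p * S.Δ p.2 := by
  have hx : (fun p : ℝ × State => p.2.x / √(1 + p.2.x ^ 2)) =O[l] fun _ => (1 : ℝ) :=
    isBigO_of_abs_le fun p => abs_div_sqrt_le_one _
  have c : (fun _ : ℝ × State => -S.kθ) =O[l] fun _ => (1 : ℝ) := isBigO_const_const _ one_ne_zero l
  have h1 := ((isBigO_mul_bounded c hx).trans one_isBigO_swaySize).mul (S.one_isBigO_Δ (l := l))
  have h2 := (isBigO_mul_bounded h.κ h.θdot_isBigO).mul (S.y_isBigO_Δ (l := l))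
  refine (h1.add h2).congr_left fun p => ?_
  rw [Setup.xdot]
  ring

lemma ydot_isBigO (h : S.Controlled l) :
    (fun p => S.ydot p.1 p.2) =O[l] fun p => swaySize p * S.Δ p.2 := by
  have hy : (fun p : ℝ × State => p.2.y / √(S.Δ p.2 ^ 2 + p.2.y ^ 2)) =O[l] fun _ => (1 : ℝ) :=
    isBigO_of_abs_le fun p => by
      rw [abs_div, abs_of_nonneg (Real.sqrt_nonneg _)]
      exact div_le_one_of_le₀ (Real.abs_le_sqrt (by nlinarith [sq_nonneg (S.Δ p.2)]))
        (Real.sqrt_nonneg _)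
  have c : (fun _ : ℝ × State => -(1 / 2 : ℝ)) =O[l] fun _ => (1 : ℝ) :=
    isBigO_const_const _ one_ne_zero l
  have h1 := (isBigO_mul_bounded c
    (isBigO_mul_bounded hy ((h.Ud_isBigO 0).add (h.Ud_isBigO 1)))).mul
    (S.one_isBigO_Δ (l := l))
  have h2 := (isBigO_mul_bounded h.κ h.θdot_isBigO).mul (S.x_isBigO_Δ (l := l))
  have h3 := h.G1_isBigO.mul (S.one_isBigO_Δ (l := l))
  refine ((h1.sub h2).add h3).congr_left fun p => ?_
  rw [Setup.ydot]
  ring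

/-- The part of the desired yaw rate that does not contain the yaw rate grows at most linearly with
the sway velocities, since the derivative of the line-of-sight angle `arctan (y / Δ)` does: the
factor `Δ` in the bounds of `ẋ` and `ẏ` is compensated by the denominator `Δ² + y²`. -/
lemma rd_zero_isBigO (h : S.Controlled l) (i : Fin 2) :
    (fun p => S.rd p.1 p.2 i 0) =O[l] swaySize := by
  have hΔ : ∀ p : ℝ × State, 0 < S.Δ p.2 ^ 2 + p.2.y ^ 2 := fun p => by
    have := S.Δ_pos p.2
    positivity
  have hinv : (fun p : ℝ × State => (S.ud i p.1 ^ 2 + p.2.v i ^ 2)⁻¹) =O[l] fun _ => (1 : ℝ) := by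
    have h1 := h.time (fun t => (S.ud i t ^ 2)⁻¹)
      (((S.continuous_ud i).pow 2).inv₀ fun t => (pow_pos (S.ud_pos i t) 2).ne')
    refine IsBigO.trans (isBigO_of_abs_le fun p => ?_) h1
    rw [abs_of_pos (inv_pos.2 (S.Ud_sq_pos p.1 p.2 i))]
    have := S.ud_pos i p.1
    exact inv_anti₀ (by positivity) (by nlinarith [sq_nonneg (p.2.v i)])
  have h1 := isBigO_mul_bounded h.κ h.θdot_isBigO
  have h2 : (fun p => S.vdot p.1 p.2 i 0) =O[l] swaySize := by
    have := isBigO_mul_bounded (h.Y_isBigO i)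
      ((v_isBigO i).sub ((vc_isBigO S i).trans one_isBigO_swaySize))
    simpa only [vdot, mul_zero, zero_add] using this
  have h3 := isBigO_mul_bounded hinv ((isBigO_mul_bounded (h.ud_isBigO i) h2).sub
    (isBigO_mul_bounded (h.time _ (S.continuous_deriv_ud i)) (v_isBigO i)))
  have hxΔ : (fun p => p.2.x / S.Δ p.2) =O[l] fun _ => (1 : ℝ) :=
    S.div_Δ_isBigO (by simpa using S.x_isBigO_Δ)
  have hyΔ : (fun p => p.2.y / S.Δ p.2) =O[l] fun _ => (1 : ℝ) :=
    S.div_Δ_isBigO (by simpa using S.y_isBigO_Δ)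
  have h4 := ((isBigO_refl (fun p : ℝ × State => S.Δ p.2) l).mul h.ydot_isBigO).sub
    ((S.y_isBigO_Δ (l := l)).mul ((isBigO_mul_bounded hxΔ h.xdot_isBigO).add
      (isBigO_mul_bounded hyΔ h.ydot_isBigO)))
  have h5 : (fun p => 1 / (S.Δ p.2 ^ 2 + p.2.y ^ 2) * (S.Δ p.2 * (swaySize p * S.Δ p.2))) =O[l]
      swaySize := by
    refine isBigO_of_abs_le fun p => ?_
    have hN : 0 < swaySize p := zero_lt_one.trans_le (one_le_swaySize p)
    have := S.Δ_pos p.2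
    rw [abs_of_nonneg (by have := hΔ p; positivity), one_div, inv_mul_eq_div, div_le_iff₀ (hΔ p)]
    nlinarith [mul_nonneg hN.le (sq_nonneg p.2.y)]
  have h6 := ((isBigO_refl (fun p : ℝ × State => 1 / (S.Δ p.2 ^ 2 + p.2.y ^ 2)) l).mul h4).trans h5
  refine ((h1.sub h3).sub h6).congr_left fun p => ?_
  rw [rd]
  ring

lemma yawRate_isBigO (h : S.Controlled l) (i : Fin 2) :
    (fun p => S.yawRate p.1 p.2 i) =O[l] swaySize := by
  have h1 := (h.s i).sub (isBigO_mul_bounded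
    (isBigO_const_const (S.gains i).lam (one_ne_zero (α := ℝ)) l) (h.ψt i))
  refine (isBigO_mul_bounded (h.yaw i) ((h.rd_zero_isBigO i).add
    (h1.trans one_isBigO_swaySize))).congr_left fun p => ?_
  rw [Setup.yawRate, rt]
  ring

lemma vdot_yawRate_isBigO (h : S.Controlled l) (i : Fin 2) :
    (fun p => S.vdot p.1 p.2 i (S.yawRate p.1 p.2 i)) =O[l] swaySize :=
  (isBigO_mul_bounded (h.X_isBigO i) (h.yawRate_isBigO i)).add
    (isBigO_mul_bounded (h.Y_isBigO i)
      ((v_isBigO i).sub ((vc_isBigO S i).trans one_isBigO_swaySize)))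

end Controlled
end Setup

lemma exists_bound_of_growth {V : ℝ → ℝ} {t₀ T C : ℝ} (hC : 0 ≤ C)
    (hV : ∀ b ∈ Ico t₀ T, AbsolutelyContinuousOnInterval V t₀ b)
    (hd : ∀ᵐ t : ℝ, t ∈ Ico t₀ T → ∃ d, HasDerivAt V d t ∧ d ≤ C * V t) :
    ∃ B, ∀ t ∈ Ico t₀ T, V t ≤ B := by
  refine ⟨|V t₀| * Real.exp (C * (T - t₀)), fun b hb => ?_⟩
  refine (le_mul_exp_of_absolutelyContinuous (C := C) hb.1 (hV b hb) ?_).trans ?_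
  · filter_upwards [hd] with t ht htI
    exact ht ⟨htI.1.le, htI.2.trans hb.2⟩
  · have hb2 := hb.2.le
    gcongr
    exact le_abs_self _

lemma mul_nonneg_of_mem_Sgn {a σ : ℝ} (h : σ ∈ Sgn a) : 0 ≤ σ * a := by
  obtain ⟨h1, h2, -⟩ := h
  rcases lt_trichotomy a 0 with ha | ha | ha
  · rw [h2 ha]
    linarith
  · rw [ha, mul_zero]
  · rw [h1 ha]
    linarith

lemma abs_le_sqrt_of_mul_self_le {a B : ℝ} (h : a * a ≤ B) : |a| ≤ √B :=
  Real.abs_le_sqrt (by rwa [sq])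

namespace Setup

variable {S : Setup} {t₀ T : ℝ} {z : ℝ → State}

/-! ### A priori bounds on bounded time intervals -/

lemma IsTrajectory.eqn_real (hz : S.IsTrajectory t₀ T z) :
    ∀ᵐ t : ℝ, t ∈ Ico t₀ T → S.ClosedLoopAt z t := by
  filter_upwards [hz.eqn] with t ht htI
  exact ht (mem_timeInterval_coe.2 htI)

lemma IsTrajectory.ac_real (hz : S.IsTrajectory t₀ T z) {b : ℝ} (hb : b ∈ Ico t₀ T) :
    ACOn z t₀ b := hz.ac b (mem_timeInterval_coe.2 hb)

/-- The surge autopilot errors are bounded. The adaptation law cancels the regressor in the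
derivative of the Lyapunov function; the damping coefficient may be negative, so that only an
exponential bound is left. -/
lemma IsTrajectory.exists_bound_surge (hz : S.IsTrajectory t₀ T z) (i : Fin 2) :
    ∃ B, ∀ t ∈ Ico t₀ T, |(z t).ut i| ≤ B ∧ ∀ k, |(z t).θu i k| ≤ B := by
  have hγ := (S.gains i).γu_pos
  set a := (S.vessel i).d11 / (S.vessel i).m11 + (S.gains i).ku with ha
  let V : ℝ → ℝ := fun t => (z t).ut i * (z t).ut i
    + (S.gains i).γu⁻¹ * ∑ k, (z t).θu i k * (z t).θu i k
  have hsum : ∀ t, 0 ≤ ∑ k, (z t).θu i k * (z t).θu i k := fun t =>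
    Finset.sum_nonneg fun k _ => mul_self_nonneg _
  obtain ⟨B, hB⟩ : ∃ B, ∀ t ∈ Ico t₀ T, V t ≤ B := by
    refine exists_bound_of_growth (C := 2 * |a|) (by positivity) (fun b hb => ?_) ?_
    · have hac := hz.ac_real hb
      exact ((hac.ut i).fun_mul (hac.ut i)).fun_add ((absolutelyContinuous_sum _ fun k _ =>
        (hac.θu i k).fun_mul (hac.θu i k)).const_mul _)
    · filter_upwards [hz.eqn_real] with t ht htI
      obtain ⟨σ, hσ, hu⟩ := (ht htI).ut i
      refine ⟨_, (hu.fun_mul hu).fun_add ((HasDerivAt.fun_sum fun k _ =>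
        ((ht htI).θu i k).fun_mul ((ht htI).θu i k)).const_mul _), ?_⟩
      rw [Finset.mul_sum]
      have e : ∀ φ : Fin 5 → ℝ, ∑ k, (S.gains i).γu⁻¹ *
          ((S.gains i).γu * φ k * (z t).ut i * (z t).θu i k
            + (z t).θu i k * ((S.gains i).γu * φ k * (z t).ut i))
          = 2 * (z t).ut i * ∑ k, φ k * (z t).θu i k := fun φ => by
        rw [Finset.mul_sum]
        refine Finset.sum_congr rfl fun k _ => ?_
        field_simp
        ring
      rw [e]
      have h1 := mul_nonneg (S.gains i).ke_pos.le (mul_nonneg_of_mem_Sgn hσ)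
      have h2 : -a * ((z t).ut i * (z t).ut i) ≤ |a| * ((z t).ut i * (z t).ut i) :=
        mul_le_mul_of_nonneg_right (neg_le_abs a) (mul_self_nonneg _)
      have h3 : 0 ≤ |a| * ((S.gains i).γu⁻¹ * ∑ k, (z t).θu i k * (z t).θu i k) :=
        mul_nonneg (abs_nonneg a) (mul_nonneg (inv_nonneg.2 hγ.le) (hsum t))
      simp only [V]
      linarith
  refine ⟨max (√B) (√((S.gains i).γu * B)), fun t ht => ⟨?_, fun k => ?_⟩⟩
  · have h1 := mul_nonneg (inv_nonneg.2 hγ.le) (hsum t)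
    have h2 := hB t ht
    exact (abs_le_sqrt_of_mul_self_le (by simp only [V] at h2; linarith)).trans (le_max_left _ _)
  · have h1 := Finset.single_le_sum (f := fun k => (z t).θu i k * (z t).θu i k)
      (fun k _ => mul_self_nonneg _) (Finset.mem_univ k)
    have h2 := hB t ht
    have h3 := mul_self_nonneg ((z t).ut i)
    have h4 : (S.gains i).γu⁻¹ * ∑ k, (z t).θu i k * (z t).θu i k ≤ B := by
      simp only [V] at h2
      linarith
    rw [inv_mul_le_iff₀ hγ] at h4
    exact (abs_le_sqrt_of_mul_self_le (h1.trans h4)).trans (le_max_right _ _)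

/-- The yaw autopilot errors are bounded: their Lyapunov function is nonincreasing. -/
lemma IsTrajectory.exists_bound_yaw (hz : S.IsTrajectory t₀ T z) (i : Fin 2) :
    ∃ B, ∀ t ∈ Ico t₀ T, |(z t).ψt i| ≤ B ∧ |(z t).s i| ≤ B ∧ ∀ k, |(z t).θr i k| ≤ B := by
  have hγ := (S.gains i).γr_pos
  have hk := (S.gains i).kψ_pos
  let V : ℝ → ℝ := fun t => ((S.gains i).kψ * ((z t).ψt i * (z t).ψt i) + (z t).s i * (z t).s i)
    + (S.gains i).γr⁻¹ * ∑ k, (z t).θr i k * (z t).θr i k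
  have hsum : ∀ t, 0 ≤ ∑ k, (z t).θr i k * (z t).θr i k := fun t =>
    Finset.sum_nonneg fun k _ => mul_self_nonneg _
  obtain ⟨B, hB⟩ : ∃ B, ∀ t ∈ Ico t₀ T, V t ≤ B := by
    refine exists_bound_of_growth le_rfl (fun b hb => ?_) ?_
    · have hac := hz.ac_real hb
      exact ((((hac.ψt i).fun_mul (hac.ψt i)).const_mul _).fun_add
        ((hac.s i).fun_mul (hac.s i))).fun_add ((absolutelyContinuous_sum _ fun k _ =>
        (hac.θr i k).fun_mul (hac.θr i k)).const_mul _)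
    · filter_upwards [hz.eqn_real] with t ht htI
      obtain ⟨σ, hσ, hs⟩ := (ht htI).s i
      have hψ := (ht htI).ψt i
      refine ⟨_, (((hψ.fun_mul hψ).const_mul _).fun_add (hs.fun_mul hs)).fun_add
        ((HasDerivAt.fun_sum fun k _ =>
          ((ht htI).θr i k).fun_mul ((ht htI).θr i k)).const_mul _), ?_⟩
      rw [Finset.mul_sum]
      have e : ∀ φ : Fin 5 → ℝ, ∑ k, (S.gains i).γr⁻¹ *
          ((S.gains i).γr * φ k * (z t).s i * (z t).θr i k
            + (z t).θr i k * ((S.gains i).γr * φ k * (z t).s i))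
          = 2 * (z t).s i * ∑ k, φ k * (z t).θr i k := fun φ => by
        rw [Finset.mul_sum]
        refine Finset.sum_congr rfl fun k _ => ?_
        field_simp
        ring
      rw [e]
      have h1 := mul_nonneg (S.gains i).kd_pos.le (mul_nonneg_of_mem_Sgn hσ)
      have h2 := mul_nonneg (S.gains i).kr_pos.le (mul_self_nonneg ((z t).s i))
      have h3 := mul_nonneg (mul_nonneg hk.le (S.gains i).lam_pos.le)
        (mul_self_nonneg ((z t).ψt i))
      linarith
  refine ⟨max (√((S.gains i).kψ⁻¹ * B)) (max (√B) (√((S.gains i).γr * B))),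
    fun t ht => ?_⟩
  have h1 := mul_nonneg (inv_nonneg.2 hγ.le) (hsum t)
  have h2 := hB t ht
  have h3 := mul_nonneg hk.le (mul_self_nonneg ((z t).ψt i))
  have h4 := mul_self_nonneg ((z t).s i)
  simp only [V] at h2
  refine ⟨?_, ?_, fun k => ?_⟩
  · refine (abs_le_sqrt_of_mul_self_le ?_).trans (le_max_left _ _)
    rw [le_inv_mul_iff₀ hk]
    linarith
  · exact (abs_le_sqrt_of_mul_self_le (by linarith)).trans
      ((le_max_left _ _).trans (le_max_right _ _))
  · have h5 := Finset.single_le_sum (f := fun k => (z t).θr i k * (z t).θr i k)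
      (fun k _ => mul_self_nonneg _) (Finset.mem_univ k)
    have h6 : (S.gains i).γr⁻¹ * ∑ k, (z t).θr i k * (z t).θr i k ≤ B := by linarith
    rw [inv_mul_le_iff₀ hγ] at h6
    exact (abs_le_sqrt_of_mul_self_le (h5.trans h6)).trans
      ((le_max_right _ _).trans (le_max_right _ _))

open Asymptotics in
/-- The bound of the curvature is uniform in `θ`, so that it is available before `θ` is known to be
bounded. -/
lemma IsTrajectory.controlled (hz : S.IsTrajectory t₀ T z) {K : ℝ}
    (hκ : ∀ θ : ℝ, |S.path.κ θ| ≤ K) {c : ℝ} (hc : 0 < c)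
    (hyaw : ∀ t ∈ Ico t₀ T, ∀ i, c ≤ |S.yawCoeff t (z t) i|) :
    S.Controlled (𝓟 ((fun t => (t, z t)) '' Ico t₀ T)) := by
  have key : ∀ f : ℝ × State → ℝ, (∃ B, ∀ t ∈ Ico t₀ T, |f (t, z t)| ≤ B) →
      f =O[𝓟 ((fun t => (t, z t)) '' Ico t₀ T)] fun _ => (1 : ℝ) := by
    rintro f ⟨B, hB⟩
    refine isBigO_principal.2 ⟨B, ?_⟩
    rintro _ ⟨t, ht, rfl⟩
    simpa using hB t ht
  refine ⟨fun f hf => key _ ?_, fun i => key _ ?_, fun i => key _ ?_, fun i => key _ ?_,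
    key _ ⟨K, fun t _ => hκ _⟩, fun i => key _ ⟨c⁻¹, fun t ht => ?_⟩⟩
  · obtain ⟨B, hB⟩ :=
      (isCompact_Icc (a := t₀) (b := T)).exists_bound_of_continuousOn hf.continuousOn
    exact ⟨B, fun t ht => hB t (Ico_subset_Icc_self ht)⟩
  · obtain ⟨B, hB⟩ := hz.exists_bound_surge i
    exact ⟨B, fun t ht => (hB t ht).1⟩
  · obtain ⟨B, hB⟩ := hz.exists_bound_yaw i
    exact ⟨B, fun t ht => (hB t ht).1⟩
  · obtain ⟨B, hB⟩ := hz.exists_bound_yaw i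
    exact ⟨B, fun t ht => (hB t ht).2.1⟩
  · rw [abs_inv]
    exact inv_anti₀ hc (hyaw t ht i)

/-- One plus the squared norm of the path-following errors, the path variable and the sway
velocities, the components of the state that the autopilot Lyapunov functions do not contain. -/
noncomputable def energy (w : State) : ℝ :=
  1 + (w.x * w.x + w.y * w.y) + w.θ * w.θ + (w.v 0 * w.v 0 + w.v 1 * w.v 1)

open Asymptotics in
/-- The derivative of `energy` along the closed loop is at most a multiple of `energy`. The products
`κ θ̇ x y` in the derivative of `x² + y²`, which would be cubic, cancel. -/
lemma Controlled.exists_energy_growth {A : Set (ℝ × State)} (h : S.Controlled (𝓟 A)) :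
    ∃ C, 0 ≤ C ∧ ∀ p ∈ A,
      2 * (p.2.x * S.xdot p.1 p.2 + p.2.y * S.ydot p.1 p.2) + 2 * (p.2.θ * S.θdot p.1 p.2)
        + 2 * (p.2.v 0 * S.vdot p.1 p.2 0 (S.yawRate p.1 p.2 0)
          + p.2.v 1 * S.vdot p.1 p.2 1 (S.yawRate p.1 p.2 1)) ≤ C * energy p.2 := by
  have hE : ∀ w : State, 1 ≤ energy w := fun w => by
    unfold energy
    nlinarith [mul_self_nonneg w.x, mul_self_nonneg w.y, mul_self_nonneg w.θ,
      mul_self_nonneg (w.v 0), mul_self_nonneg (w.v 1)]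
  have hle : ∀ (w : State) (a : ℝ), a * a ≤ energy w → |a| ≤ √(energy w) := fun w a =>
    abs_le_sqrt_of_mul_self_le
  have hx2 := fun w : State => mul_self_nonneg w.x
  have hy2 := fun w : State => mul_self_nonneg w.y
  have hθ2 := fun w : State => mul_self_nonneg w.θ
  have hv2 := fun (w : State) i => mul_self_nonneg (w.v i)
  have hy : (fun p : ℝ × State => p.2.y) =O[𝓟 A] fun p => √(energy p.2) :=
    isBigO_of_abs_le fun p => hle _ _ (by
      unfold energy; linarith [hx2 p.2, hθ2 p.2, hv2 p.2 0, hv2 p.2 1])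
  have hθ : (fun p : ℝ × State => p.2.θ) =O[𝓟 A] fun p => √(energy p.2) :=
    isBigO_of_abs_le fun p => hle _ _ (by
      unfold energy; linarith [hx2 p.2, hy2 p.2, hv2 p.2 0, hv2 p.2 1])
  have hv0 : (fun p : ℝ × State => p.2.v 0) =O[𝓟 A] fun p => √(energy p.2) :=
    isBigO_of_abs_le fun p => hle _ _ (by
      unfold energy; linarith [hx2 p.2, hy2 p.2, hθ2 p.2, hv2 p.2 1])
  have hv1 : (fun p : ℝ × State => p.2.v 1) =O[𝓟 A] fun p => √(energy p.2) :=
    isBigO_of_abs_le fun p => hle _ _ (by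
      unfold energy; linarith [hx2 p.2, hy2 p.2, hθ2 p.2, hv2 p.2 0])
  have h1 : (fun _ : ℝ × State => (1 : ℝ)) =O[𝓟 A] fun p => √(energy p.2) :=
    isBigO_of_abs_le fun p => hle _ _ (by linarith [hE p.2])
  have hN : swaySize =O[𝓟 A] fun p => √(energy p.2) := (h1.add hv0.abs_left).add hv1.abs_left
  have hmain := ((((hy.mul (h.G1_isBigO.trans hN)).add (hθ.mul (h.θdot_isBigO.trans hN))).add
    (hv0.mul ((h.vdot_yawRate_isBigO 0).trans hN))).add
    (hv1.mul ((h.vdot_yawRate_isBigO 1).trans hN)))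
  obtain ⟨C, hC⟩ := isBigO_principal.1 hmain
  refine ⟨2 * |C|, by positivity, fun p hp => ?_⟩
  -- The terms of `x ẋ + y ẏ` other than `y G₁` are nonpositive or cancel.
  have hp' := (le_abs_self _).trans (hC p hp)
  rw [Real.mul_self_sqrt (by linarith [hE p.2]), Real.norm_of_nonneg (by linarith [hE p.2])] at hp'
  have hCE := mul_le_mul_of_nonneg_right (le_abs_self C) (by linarith [hE p.2] : 0 ≤ energy p.2)
  have hX : 0 ≤ S.kθ * (p.2.x * p.2.x / √(1 + p.2.x ^ 2)) :=
    mul_nonneg S.kθ_pos.le (div_nonneg (hx2 _) (Real.sqrt_nonneg _))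
  have hY : 0 ≤ 1 / 2 * (S.Ud p.1 p.2 0 + S.Ud p.1 p.2 1) *
      (p.2.y * p.2.y / √(S.Δ p.2 ^ 2 + p.2.y ^ 2)) :=
    mul_nonneg (mul_nonneg (by norm_num) (add_nonneg (Real.sqrt_nonneg _) (Real.sqrt_nonneg _)))
      (div_nonneg (hy2 _) (Real.sqrt_nonneg _))
  have e : p.2.x * S.xdot p.1 p.2 + p.2.y * S.ydot p.1 p.2 =
      -(S.kθ * (p.2.x * p.2.x / √(1 + p.2.x ^ 2)))
      - 1 / 2 * (S.Ud p.1 p.2 0 + S.Ud p.1 p.2 1) * (p.2.y * p.2.y / √(S.Δ p.2 ^ 2 + p.2.y ^ 2))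
      + p.2.y * S.G1 p.1 p.2 := by
    rw [Setup.xdot, Setup.ydot]
    ring
  rw [e]
  linarith

lemma IsTrajectory.exists_bound_energy (hz : S.IsTrajectory t₀ T z)
    (h : S.Controlled (𝓟 ((fun t => (t, z t)) '' Ico t₀ T))) :
    ∃ B, ∀ t ∈ Ico t₀ T, energy (z t) ≤ B := by
  obtain ⟨C, hC0, hC⟩ := h.exists_energy_growth
  refine exists_bound_of_growth hC0 (fun b hb => ?_) ?_
  · have hac := hz.ac_real hb
    have h1 : AbsolutelyContinuousOnInterval (fun _ => (1 : ℝ)) t₀ b :=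
      (LipschitzWith.const (1 : ℝ)).lipschitzOnWith.absolutelyContinuousOnInterval
    exact ((h1.fun_add ((hac.x.fun_mul hac.x).fun_add (hac.y.fun_mul hac.y))).fun_add
      (hac.θ.fun_mul hac.θ)).fun_add
      (((hac.v 0).fun_mul (hac.v 0)).fun_add ((hac.v 1).fun_mul (hac.v 1)))
  · filter_upwards [hz.eqn_real] with t ht htI
    have hcl := ht htI
    refine ⟨_, ((((hasDerivAt_const t (1 : ℝ)).fun_add ((hcl.x.fun_mul hcl.x).fun_add
      (hcl.y.fun_mul hcl.y))).fun_add (hcl.θ.fun_mul hcl.θ)).fun_add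
      (((hcl.v 0).fun_mul (hcl.v 0)).fun_add ((hcl.v 1).fun_mul (hcl.v 1)))), ?_⟩
    have := hC (t, z t) ⟨t, htI, rfl⟩
    dsimp only at this
    linarith

lemma IsTrajectory.exists_bound (hz : S.IsTrajectory t₀ T z) {K : ℝ}
    (hκ : ∀ θ : ℝ, |S.path.κ θ| ≤ K) {c : ℝ} (hc : 0 < c)
    (hyaw : ∀ t ∈ Ico t₀ T, ∀ i, c ≤ |S.yawCoeff t (z t) i|) :
    ∃ B, ∀ t ∈ Ico t₀ T, ‖(z t).coord‖ ≤ B := by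
  obtain ⟨B, hB⟩ := hz.exists_bound_energy (hz.controlled hκ hc hyaw)
  choose Bu hBu using hz.exists_bound_surge
  choose Br hBr using hz.exists_bound_yaw
  have hE : ∀ t ∈ Ico t₀ T, ∀ a, a * a ≤ energy (z t) → |a| ≤ √B := fun t ht a ha =>
    abs_le_sqrt_of_mul_self_le (ha.trans (hB t ht))
  have hB1 : ∀ i, Bu i ≤ ∑ i, (|Bu i| + |Br i|) := fun i =>
    ((le_abs_self _).trans (le_add_of_nonneg_right (abs_nonneg _))).trans
      (Finset.single_le_sum (f := fun i => |Bu i| + |Br i|) (fun i _ => by positivity)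
        (Finset.mem_univ i))
  have hB2 : ∀ i, Br i ≤ ∑ i, (|Bu i| + |Br i|) := fun i =>
    ((le_abs_self _).trans (le_add_of_nonneg_left (abs_nonneg _))).trans
      (Finset.single_le_sum (f := fun i => |Bu i| + |Br i|) (fun i _ => by positivity)
        (Finset.mem_univ i))
  refine ⟨max (√B) (∑ i, (|Bu i| + |Br i|)), fun t ht => ?_⟩
  refine (pi_norm_le_iff_of_nonneg (le_max_of_le_left (Real.sqrt_nonneg _))).2 fun k => ?_
  have hx2 := mul_self_nonneg (z t).x
  have hy2 := mul_self_nonneg (z t).y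
  have hθ2 := mul_self_nonneg (z t).θ
  have hv2 := fun i => mul_self_nonneg ((z t).v i)
  have h0 := hv2 0
  have h1 := hv2 1
  cases k with
  | x => exact (hE t ht (z t).x (by unfold energy; linarith)).trans (le_max_left _ _)
  | y => exact (hE t ht (z t).y (by unfold energy; linarith)).trans (le_max_left _ _)
  | θ => exact (hE t ht (z t).θ (by unfold energy; linarith)).trans (le_max_left _ _)
  | v i =>
    refine (hE t ht ((z t).v i) ?_).trans (le_max_left _ _)
    unfold energy
    fin_cases i <;> simp only [Fin.zero_eta, Fin.mk_one] <;> linarith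
  | ut i => exact ((hBu i t ht).1.trans (hB1 i)).trans (le_max_right _ _)
  | θu i k => exact (((hBu i t ht).2 k).trans (hB1 i)).trans (le_max_right _ _)
  | ψt i => exact ((hBr i t ht).1.trans (hB2 i)).trans (le_max_right _ _)
  | s i => exact ((hBr i t ht).2.1.trans (hB2 i)).trans (le_max_right _ _)
  | θr i k => exact (((hBr i t ht).2.2 k).trans (hB2 i)).trans (le_max_right _ _)

lemma IsTrajectory.exists_lipschitz (hz : S.IsTrajectory t₀ T z) {K : ℝ}
    (hκ : ∀ θ : ℝ, |S.path.κ θ| ≤ K) {c : ℝ} (hc : 0 < c)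
    (hyaw : ∀ t ∈ Ico t₀ T, ∀ i, c ≤ |S.yawCoeff t (z t) i|) :
    ∃ L : NNReal, LipschitzOnWith L (fun t => (z t).coord) (Ico t₀ T) := by
  obtain ⟨B, hB⟩ := hz.exists_bound hκ hc hyaw
  -- The states of the trajectory lie in a compact part of the domain of the vector field.
  let Q : Set (ℝ × (Coord → ℝ)) := (Icc t₀ T ×ˢ Metric.closedBall 0 B) ∩
    ⋂ i, {q | c ≤ |S.yawCoeff q.1 (State.ofCoord q.2) i|}
  have hQ : IsCompact Q := (isCompact_Icc.prod (isCompact_closedBall 0 B)).inter_right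
    (isClosed_iInter fun i => isClosed_le continuous_const (S.continuous_yawCoeff i).abs)
  have hQD : Q ⊆ S.coordDomain := fun q hq i =>
    abs_pos.1 (hc.trans_le (mem_iInter.1 hq.2 i))
  obtain ⟨M, hM⟩ := hQ.exists_bound_of_continuousOn (S.continuousOn_drift.mono hQD)
  have hMz : ∀ t ∈ Ico t₀ T, ∀ k, |S.drift t (z t) k| ≤ |M| := fun t ht k =>
    ((norm_le_pi_norm (S.drift t (z t)) k).trans (hM (t, (z t).coord)
      ⟨⟨Ico_subset_Icc_self ht, mem_closedBall_zero_iff.2 (hB t ht)⟩,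
        mem_iInter.2 fun i => hyaw t ht i⟩)).trans (le_abs_self M)
  have hL0 : 0 ≤ |M| + ‖S.signGain‖ := by positivity
  have hmono : ∀ a ∈ Ico t₀ T, ∀ b ∈ Ico t₀ T, a ≤ b →
      dist (z a).coord (z b).coord ≤ (|M| + ‖S.signGain‖) * (b - a) := by
    intro a ha b hb hab
    refine (dist_pi_le_iff (mul_nonneg hL0 (sub_nonneg.2 hab))).2 fun k => ?_
    rw [dist_comm, Real.dist_eq]
    refine abs_sub_le_of_absolutelyContinuous (g := fun t => (z t).coord k) hab
      ((aCOn_iff.1 (hz.ac_real hb) k).mono ?_) ?_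
    · rw [uIcc_of_le hab, uIcc_of_le hb.1]
      exact Icc_subset_Icc_left ha.1
    · filter_upwards [hz.eqn_real] with t ht htI
      have htI' : t ∈ Ico t₀ T := ⟨ha.1.trans htI.1.le, htI.2.trans hb.2⟩
      obtain ⟨σ, hσ, hd⟩ := (S.closedLoopAt_iff.1 (ht htI')) k
      refine ⟨_, hd, (abs_sub _ _).trans (add_le_add (hMz t htI' k) ?_)⟩
      rw [abs_mul]
      exact (mul_le_of_le_one_right (abs_nonneg _) hσ.2.2).trans (norm_le_pi_norm S.signGain k)
  refine ⟨⟨_, hL0⟩, LipschitzOnWith.of_dist_le_mul fun a ha b hb => ?_⟩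
  rcases le_total a b with hab | hab
  · rw [dist_comm a b, Real.dist_eq, abs_of_nonneg (sub_nonneg.2 hab)]
    exact hmono a ha b hb hab
  · rw [dist_comm (z a).coord, Real.dist_eq, abs_of_nonneg (sub_nonneg.2 hab)]
    exact hmono b hb a ha hab

theorem IsMaximalTrajectory.eq_top (hκ : ∃ K : ℝ, ∀ θ : ℝ, |S.path.κ θ| ≤ K) {T : EReal}
    (hz : S.IsMaximalTrajectory t₀ T z) (hyaw : S.YawRegular t₀ T z) : T = ⊤ := by
  obtain ⟨K, hK⟩ := hκ
  induction T with
  | bot => exact absurd hz.lt not_lt_bot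
  | top => rfl
  | coe T =>
    exfalso
    obtain ⟨c, hc, hc'⟩ := hyaw T
    have hyaw' : ∀ t ∈ Ico t₀ T, ∀ i, c ≤ |S.yawCoeff t (z t) i| := fun t ht =>
      hc' t (mem_timeInterval_coe.2 ht) ht.2.le
    obtain ⟨L, hL⟩ := hz.toIsTrajectory.exists_lipschitz hK hc hyaw'
    obtain ⟨T', z', hT', hz', heq⟩ := hz.toIsTrajectory.exists_extension hL hc hyaw'
    refine hT'.not_ge (hz.maximal T' z' hz' fun t ht => heq (mem_timeInterval_coe.1 ht.1))

end Setup

end BarycenterPathFollowing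

open BarycenterPathFollowing in
theorem lemma1 (S : Setup) (hκ : ∃ K : ℝ, ∀ θ : ℝ, |S.path.κ θ| ≤ K) :
    (∀ (t₀ : ℝ) (z₀ : State), (∀ i, S.yawCoeff t₀ z₀ i ≠ 0) →
      ∃ (T : EReal) (z : ℝ → State), S.IsMaximalTrajectory t₀ T z ∧ z t₀ = z₀) ∧
    (∀ (t₀ : ℝ) (T : EReal) (z : ℝ → State), S.IsMaximalTrajectory t₀ T z →
      S.YawRegular t₀ T z → T = ⊤) :=
  ⟨fun _ _ h₀ => S.exists_isMaximalTrajectory h₀, fun _ _ _ hz hyaw => hz.eq_top hκ hyaw⟩
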